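/- Let $\mathbb T^2=\mathbb R^2/2\pi\mathbb Z^2$, and let $z=x_1+ix_2$ be the standard complex coordinate on $\mathbb R^2$; the forms $dz$ and $d\bar z$ descend to $\mathbb T^2$. Let $\nu:\mathbb T^2\times[0,1]\to\mathbb C$ be a $C^\infty$ family of functions on $\mathbb T^2$ depending on the parameter $t\in[0,1]$ (that is, $\nu(z,t)$ is jointly $C^\infty$ on $\mathbb T^2\times[0,1]$, up to the endpoints of $[0,1]$), with $|\nu(z,t)|<1$ everywhere. Then there exists a $C^\infty$ family $f:\mathbb T^2\times[0,1]\to\mathbb C\setminus\{0\}$ of nowhere vanishing functions on $\mathbb T^2$ such that for every fixed $t\in[0,1]$ the 1-form $f(\cdot,t)\,(dz+\nu(\cdot,t)\,d\bar z)$ on $\mathbb T^2$ is closed, and its pullback to $\mathbb R^2$ under the standard projection $\mathbb R^2\to\mathbb T^2$ is the differential of a $C^\infty$ diffeomorphism of $\mathbb R^2$ onto $\mathbb C$. -/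

import Mathlib

open Set
open scoped ContDiff Manifold

/-- The lattice `2πℤ²` in `ℝ²`, where `ℝ²` is identified with `ℂ` by the complex coordinate
`z = x₁ + i x₂`. -/
def periodLattice : AddSubgroup ℂ where
  carrier := {w | ∃ m n : ℤ, w = 2 * Real.pi * m + 2 * Real.pi * n * Complex.I}
  zero_mem' := ⟨0, 0, by simp⟩
  add_mem' := by
    rintro a b ⟨m, n, rfl⟩ ⟨m', n', rfl⟩
    exact ⟨m + m', n + n', by push_cast; ring⟩
  neg_mem' := by
    rintro a ⟨m, n, rfl⟩
    exact ⟨-m, -n, by push_cast; ring⟩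

/-- The torus `𝕋² = ℝ² / 2πℤ²`. -/
abbrev Torus2 : Type := ℂ ⧸ periodLattice

/-- The standard projection `ℝ² → 𝕋²`. -/
def torusProj (z : ℂ) : Torus2 := QuotientAddGroup.mk z

/-- A `C^∞` family of complex functions on `𝕋²` depending on the parameter `t ∈ [0,1]`:
a function on `𝕋² × [0,1]` that is jointly `C^∞`, up to the endpoints of `[0,1]`.
The smooth structure of `𝕋²` is the quotient one, so smoothness is smoothness of the lift to
`ℝ² × [0,1]`. -/
def IsSmoothFamily (u : Torus2 → Icc (0 : ℝ) 1 → ℂ) : Prop :=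
  ContDiffOn ℝ ∞
    (fun p : ℂ × ℝ => u (torusProj p.1) (projIcc (0 : ℝ) 1 zero_le_one p.2))
    (univ ×ˢ Icc (0 : ℝ) 1)

/-- Complex-valued differential 1-forms on `𝕋²`. All tangent spaces of `𝕋²` are identified with
`ℝ² = ℂ` through the standard projection. -/
abbrev TorusOneForm : Type := Torus2 → (ℂ →L[ℝ] ℂ)

/-- The form `g · (dz + μ dz̄)` on `𝕋²`, for functions `g` and `μ` on `𝕋²`. -/
noncomputable def beltramiForm (g μ : Torus2 → ℂ) : TorusOneForm := fun x =>
  g x • (ContinuousLinearMap.id ℝ ℂ + μ x • (Complex.conjCLE : ℂ →L[ℝ] ℂ))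

/-- The pullback of a 1-form on `𝕋²` to `ℝ²` under the standard projection. -/
def TorusOneForm.pullback (α : TorusOneForm) : ℂ → (ℂ →L[ℝ] ℂ) := fun z => α (torusProj z)

/-- A 1-form on `𝕋²` is closed: it is differentiable and its exterior derivative, computed in the
local coordinates given by the standard projection, vanishes. -/
def TorusOneForm.IsClosed (α : TorusOneForm) : Prop :=
  Differentiable ℝ α.pullback ∧
    ∀ z : ℂ, extDeriv
      (fun w => ContinuousAlternatingMap.ofSubsingleton ℝ ℂ ℂ (0 : Fin 1) (α.pullback w)) z = 0

/-! The form `f (dz + ν dz̄)` is closed exactly when `f_z̄ = (ν f)_z`. With `f = exp φ` this becomes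
the linear equation `φ_z̄ - ν φ_z = ν_z`. Setting `ψ = φ_z̄` and `S = ∂_z ∂_z̄⁻¹`, it reads `ψ - ν S
ψ = ν_z`; since `S` has norm at most 1 on `L²` and `sup |ν| < 1` at each time, a Neumann series
solves it uniquely.

Regularity comes from translations rather than elliptic estimates. The translate of `ν(·, t)` by `y`
is a smooth function of `(y, t)` with values in `C(𝕋²)` (`contDiffOn_torusTranslate`), and solving
is smooth in the data (`contDiffOn_beltramiSolve`). By uniqueness the solution for translated data
is the translated solution, so `ψ` has a smooth orbit in `L²`. Pairing the Laplacian of this orbit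
with a fixed `L²` kernel yields a genuinely smooth `φ` (`exists_beltrami_potential`).

Only functions of mean zero have the form `φ_z̄`, so the equation holds up to a constant `-c`, with
`c` the mean of `ψ`. For `g = exp φ` this says `g_z̄ - (ν g)_z = -c g`, and integration gives `c ·
mean g = 0`. If `c = 0`, the mean of `g` is nonzero, because a solution of mean zero vanishes
(`eq_zero_of_mean_eq_zero`). Along the path `s ν`, `0 ≤ s ≤ 1`, the set `c = 0` is therefore open
and closed, and it contains `s = 0`; hence `c = 0` (`beltrami_obstruction_eq_zero`).

The closed form has a primitive `Φ` on the plane, a local diffeomorphism because `|ν| < 1`. As its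
derivative is periodic, `Φ` is linear plus periodic; the linear part is invertible, so `Φ` is
proper, hence a covering of the simply connected plane and a diffeomorphism
(`exists_diffeomorph_of_periodic_fderiv`). -/

section TorusBeltrami

open Topology Filter
open scoped Pointwise

/-! ### Differentiability of maps into `C(K, ℂ)` -/

section ContinuousMapValued

variable {K E : Type*} [TopologicalSpace K] [CompactSpace K] [NormedAddCommGroup E]
  [NormedSpace ℝ E]

/-- A map into `C(K, ℂ)` that is differentiable after evaluation at each point, with derivatives
assembling to a continuous field of operators, is differentiable. -/
theorem hasFDerivWithinAt_of_forall_eval {U : E → C(K, ℂ)} {U' : E → E →L[ℝ] C(K, ℂ)} {D : Set E}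
    (hD : Convex ℝ D) (hU' : ContinuousOn U' D)
    (h : ∀ x, ∀ p ∈ D, HasFDerivWithinAt (fun p => U p x)
      ((ContinuousMap.evalCLM ℝ x).comp (U' p)) D p) {p : E} (hp : p ∈ D) :
    HasFDerivWithinAt U (U' p) D p := by
  rw [hasFDerivWithinAt_iff_isLittleO, Asymptotics.isLittleO_iff]
  intro ε hε
  obtain ⟨δ, hδ, hball⟩ := Metric.continuousOn_iff.1 hU' p hp ε hε
  have hnear : ∀ᶠ y in 𝓝[D] p, y ∈ D ∩ Metric.ball p δ :=
    inter_mem self_mem_nhdsWithin (mem_nhdsWithin_of_mem_nhds (Metric.ball_mem_nhds p hδ))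
  filter_upwards [hnear] with y hy
  rw [ContinuousMap.norm_le _ (by positivity)]
  intro x
  -- The radius `δ` does not depend on `x`, so the mean value inequality bounds the remainder in the
  -- sup norm.
  have key := (hD.inter (convex_ball p δ)).norm_image_sub_le_of_norm_hasFDerivWithin_le'
    (f := fun p => U p x) (f' := fun p => (ContinuousMap.evalCLM ℝ x).comp (U' p))
    (φ := (ContinuousMap.evalCLM ℝ x).comp (U' p)) (C := ε)
    (fun z hz => (h x z hz.1).mono inter_subset_left) (fun z hz => ?_)
    ⟨hp, Metric.mem_ball_self hδ⟩ hy
  · simpa using key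
  · refine ContinuousLinearMap.opNorm_le_bound _ hε.le fun v => ?_
    calc ‖(((ContinuousMap.evalCLM ℝ x).comp (U' z) -
            (ContinuousMap.evalCLM ℝ x).comp (U' p)) v : ℂ)‖ = ‖(U' z v - U' p v) x‖ := by simp
      _ ≤ ‖(U' z - U' p) v‖ := ContinuousMap.norm_coe_le_norm _ x
      _ ≤ ‖U' z - U' p‖ * ‖v‖ := ContinuousLinearMap.le_opNorm _ _
      _ ≤ ε * ‖v‖ := by
        gcongr
        rw [← dist_eq_norm]
        exact (hball z hz.1 hz.2).le

end ContinuousMapValued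

/-! ### Calculus on the strip and periodic families -/

/-- The closed strip `ℝ² × [0,1]`. -/
def strip : Set (ℂ × ℝ) := univ ×ˢ Icc (0 : ℝ) 1

theorem mem_strip {p : ℂ × ℝ} : p ∈ strip ↔ p.2 ∈ Icc (0 : ℝ) 1 := by simp [strip]

theorem convex_strip : Convex ℝ strip := convex_univ.prod (convex_Icc 0 1)

theorem uniqueDiffOn_strip : UniqueDiffOn ℝ strip :=
  uniqueDiffOn_univ.prod (uniqueDiffOn_Icc zero_lt_one)

theorem vadd_strip (l : ℂ) : ((l, 0) : ℂ × ℝ) +ᵥ strip = strip := by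
  ext p
  rw [Set.mem_vadd_set_iff_neg_vadd_mem]
  simp [mem_strip]

/-- The derivative of a map on the strip in a fixed direction. -/
noncomputable def stripDeriv {E : Type*} [NormedAddCommGroup E] [NormedSpace ℝ E]
    (v : ℂ × ℝ) (u : ℂ × ℝ → E) : ℂ × ℝ → E := fun p => fderivWithin ℝ u strip p v

section StripDeriv

variable {E : Type*} [NormedAddCommGroup E] [NormedSpace ℝ E] {u : ℂ × ℝ → E}

theorem contDiffOn_stripDeriv (hu : ContDiffOn ℝ ∞ u strip) (v : ℂ × ℝ) :
    ContDiffOn ℝ ∞ (stripDeriv v u) strip :=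
  (hu.fderivWithin uniqueDiffOn_strip (m := ∞) (by simp)).clm_apply contDiffOn_const

theorem ContDiffOn.hasFDerivWithinAt_strip (hu : ContDiffOn ℝ ∞ u strip) {p : ℂ × ℝ}
    (hp : p ∈ strip) : HasFDerivWithinAt u (fderivWithin ℝ u strip p) strip p :=
  (hu.differentiableOn (by simp) p hp).hasFDerivWithinAt

theorem hasFDerivAt_slice (hu : ContDiffOn ℝ ∞ u strip) {p : ℂ × ℝ} (hp : p ∈ strip) :
    HasFDerivAt (fun z => u (z, p.2))
      ((fderivWithin ℝ u strip p).comp (ContinuousLinearMap.inl ℝ ℂ ℝ)) p.1 := by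
  rw [← hasFDerivWithinAt_univ]
  refine HasFDerivWithinAt.comp (t := strip) p.1 (hu.hasFDerivWithinAt_strip hp)
    (hasFDerivAt_prodMk_left p.1 p.2).hasFDerivWithinAt fun z _ => ?_
  rw [mem_strip] at hp ⊢
  exact hp

theorem stripDeriv_eq_fderiv_slice (hu : ContDiffOn ℝ ∞ u strip) {p : ℂ × ℝ} (hp : p ∈ strip)
    (v : ℂ) : stripDeriv (v, 0) u p = fderiv ℝ (fun z => u (z, p.2)) p.1 v := by
  rw [(hasFDerivAt_slice hu hp).fderiv]
  simp [stripDeriv]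

theorem contDiff_slice (hu : ContDiffOn ℝ ∞ u strip) {t : ℝ} (ht : t ∈ Icc (0 : ℝ) 1) :
    ContDiff ℝ ∞ (fun z => u (z, t)) := by
  rw [← contDiffOn_univ]
  exact hu.comp (t := strip) (contDiff_id.prodMk contDiff_const).contDiffOn
    fun z _ => mem_strip.2 ht

end StripDeriv

/-- A smooth family on the strip, periodic in the space variable. -/
structure IsPeriodicFamily (u : ℂ × ℝ → ℂ) : Prop where
  contDiffOn : ContDiffOn ℝ ∞ u strip
  periodic : ∀ l ∈ periodLattice, ∀ z, ∀ t ∈ Icc (0 : ℝ) 1, u (z + l, t) = u (z, t)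

namespace IsPeriodicFamily

variable {u w : ℂ × ℝ → ℂ}

theorem const (c : ℂ) : IsPeriodicFamily fun _ => c := ⟨contDiffOn_const, fun _ _ _ _ _ => rfl⟩

theorem mul (hu : IsPeriodicFamily u) (hw : IsPeriodicFamily w) :
    IsPeriodicFamily fun p => u p * w p :=
  ⟨hu.1.mul hw.1, fun l hl z t ht => by rw [hu.2 l hl z t ht, hw.2 l hl z t ht]⟩

theorem add (hu : IsPeriodicFamily u) (hw : IsPeriodicFamily w) :
    IsPeriodicFamily fun p => u p + w p :=
  ⟨hu.1.add hw.1, fun l hl z t ht => by rw [hu.2 l hl z t ht, hw.2 l hl z t ht]⟩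

theorem sub (hu : IsPeriodicFamily u) (hw : IsPeriodicFamily w) :
    IsPeriodicFamily fun p => u p - w p :=
  ⟨hu.1.sub hw.1, fun l hl z t ht => by rw [hu.2 l hl z t ht, hw.2 l hl z t ht]⟩

theorem const_mul (c : ℂ) (hu : IsPeriodicFamily u) : IsPeriodicFamily fun p => c * u p :=
  (const c).mul hu

theorem cexp (hu : IsPeriodicFamily u) : IsPeriodicFamily fun p => Complex.exp (u p) :=
  ⟨hu.1.cexp, fun l hl z t ht => by rw [hu.2 l hl z t ht]⟩

theorem stripDeriv (hu : IsPeriodicFamily u) (v : ℂ × ℝ) : IsPeriodicFamily (stripDeriv v u) := by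
  refine ⟨contDiffOn_stripDeriv hu.1 v, fun l hl z t ht => ?_⟩
  have h : EqOn (fun p : ℂ × ℝ => u (p + (l, 0))) u strip := fun p hp =>
    (congrArg u (by ext <;> simp)).trans (hu.2 l hl p.1 p.2 (mem_strip.1 hp))
  have := fderivWithin_comp_add_right (𝕜 := ℝ) (f := u) (s := strip) (x := (z, t)) (l, 0)
  rw [fderivWithin_congr h (h (mem_strip.2 ht)), vadd_strip] at this
  simp only [_root_.stripDeriv, this]
  simp

end IsPeriodicFamily

/-! ### The unit torus as a quotient of the plane, and translates of families -/

/-- The universal covering `ℝ² → (ℝ/ℤ)²` with kernel `2πℤ²`. -/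
noncomputable def coverMap (z : ℂ) : UnitAddTorus (Fin 2) :=
  fun i => ((![z.re / (2 * Real.pi), z.im / (2 * Real.pi)] i : ℝ) : UnitAddCircle)

theorem coverMap_add (z w : ℂ) : coverMap (z + w) = coverMap z + coverMap w := by
  funext i
  fin_cases i <;> simp [coverMap, add_div]

theorem isOpenQuotientMap_coverMap : IsOpenQuotientMap coverMap := by
  have h1 : IsOpenQuotientMap (Pi.map fun (_ : Fin 2) (x : ℝ) => (x : UnitAddCircle)) :=
    IsOpenQuotientMap.piMap fun _ => QuotientAddGroup.isOpenQuotientMap_mk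
  let e : ℂ ≃ₜ (Fin 2 → ℝ) :=
    { toFun := fun z => ![z.re / (2 * Real.pi), z.im / (2 * Real.pi)]
      invFun := fun x => ⟨2 * Real.pi * x 0, 2 * Real.pi * x 1⟩
      left_inv := fun z => by
        have := Real.pi_pos.ne'
        apply Complex.ext <;> simp <;> field_simp
      right_inv := fun x => by
        have := Real.pi_pos.ne'
        funext i
        fin_cases i <;> simp
      continuous_toFun := by
        refine continuous_pi fun i => ?_
        fin_cases i
        · exact Complex.continuous_re.div_const _
        · exact Complex.continuous_im.div_const _
      continuous_invFun := by
        have : (fun x : Fin 2 → ℝ => (⟨2 * Real.pi * x 0, 2 * Real.pi * x 1⟩ : ℂ)) =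
            fun x => Complex.equivRealProdCLM.symm (2 * Real.pi * x 0, 2 * Real.pi * x 1) := rfl
        rw [this]
        fun_prop }
  exact h1.comp e.isOpenQuotientMap

theorem sub_mem_periodLattice_of_coverMap_eq {z w : ℂ} (h : coverMap z = coverMap w) :
    z - w ∈ periodLattice := by
  have hpi := Real.pi_pos.ne'
  have h0 := congrFun h 0
  have h1 := congrFun h 1
  simp only [coverMap, Matrix.cons_val_zero, Matrix.cons_val_one, Fin.isValue] at h0 h1
  rw [← sub_eq_zero, ← AddCircle.coe_sub, AddCircle.coe_eq_zero_iff] at h0 h1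
  obtain ⟨m, hm⟩ := h0
  obtain ⟨n, hn⟩ := h1
  have hm' : z.re - w.re = 2 * Real.pi * m := by
    field_simp at hm
    simp only [zsmul_one] at hm
    linarith [hm]
  have hn' : z.im - w.im = 2 * Real.pi * n := by
    field_simp at hn
    simp only [zsmul_one] at hn
    linarith [hn]
  exact ⟨m, n, Complex.ext (by simpa using hm') (by simpa using hn')⟩

theorem coverMap_add_period {l : ℂ} (hl : l ∈ periodLattice) (z : ℂ) :
    coverMap (z + l) = coverMap z := by
  obtain ⟨m, n, rfl⟩ := hl
  have hpi := Real.pi_pos.ne'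
  rw [coverMap_add, add_eq_left]
  funext i
  fin_cases i
  all_goals
    simp only [coverMap, Pi.zero_apply]
    rw [AddCircle.coe_eq_zero_iff]
  · exact ⟨m, by simp⟩
  · exact ⟨n, by simp⟩

theorem mFourier_coverMap (n : Fin 2 → ℤ) (z : ℂ) :
    UnitAddTorus.mFourier n (coverMap z) = Complex.exp (Complex.I * (n 0 * z.re + n 1 * z.im)) := by
  have hpi : (Real.pi : ℂ) ≠ 0 := by exact_mod_cast Real.pi_pos.ne'
  simp only [UnitAddTorus.mFourier, coverMap, ContinuousMap.coe_mk, Fin.prod_univ_two,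
    Matrix.cons_val_zero, Matrix.cons_val_one, Fin.isValue, fourier_coe_apply, ← Complex.exp_add]
  congr 1
  push_cast
  field_simp

/-- The continuous function on the torus whose pullback to the plane is a given periodic
function. -/
noncomputable def torusDescend (F : ℂ → ℂ) : C(UnitAddTorus (Fin 2), ℂ) :=
  open Classical in
  -- The section is not continuous, but its composite with a continuous periodic `F` is; the default
  -- `0` does not occur for such `F`.
  if h : Continuous fun x => F (Function.surjInv isOpenQuotientMap_coverMap.surjective x) then
    ⟨_, h⟩ else 0

theorem torusDescend_coverMap {F : ℂ → ℂ} (hF : Continuous F)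
    (hper : ∀ l ∈ periodLattice, ∀ z, F (z + l) = F z) (z : ℂ) :
    torusDescend F (coverMap z) = F z := by
  have key : ∀ z, F (Function.surjInv isOpenQuotientMap_coverMap.surjective (coverMap z)) = F z := by
    intro z
    have := hper _ (sub_mem_periodLattice_of_coverMap_eq
      (Function.surjInv_eq isOpenQuotientMap_coverMap.surjective (coverMap z))) z
    rwa [add_sub_cancel] at this
  have hc : Continuous fun x =>
      F (Function.surjInv isOpenQuotientMap_coverMap.surjective x) := by
    rw [← isOpenQuotientMap_coverMap.continuous_comp_iff]
    exact hF.congr fun z => (key z).symm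
  rw [torusDescend, dif_pos hc]
  exact key z

/-- The member at time `p.2` of a periodic family, translated by `p.1`, as a continuous function on
the torus. -/
noncomputable def torusTranslate (u : ℂ × ℝ → ℂ) (p : ℂ × ℝ) : C(UnitAddTorus (Fin 2), ℂ) :=
  torusDescend fun z => u (p.1 + z, p.2)

namespace IsPeriodicFamily

variable {u w : ℂ × ℝ → ℂ}

theorem torusTranslate_apply (hu : IsPeriodicFamily u) {p : ℂ × ℝ} (hp : p ∈ strip) (z : ℂ) :
    torusTranslate u p (coverMap z) = u (p.1 + z, p.2) :=
  torusDescend_coverMap (F := fun z => u (p.1 + z, p.2))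
    ((contDiff_slice hu.1 (mem_strip.1 hp)).continuous.comp (continuous_const.add continuous_id))
    (fun l hl z => by simp only [← add_assoc, hu.2 l hl _ _ (mem_strip.1 hp)]) z

theorem continuousOn_torusTranslate (hu : IsPeriodicFamily u) :
    ContinuousOn (torusTranslate u) strip := by
  rw [continuousOn_iff_continuous_domRestrict]
  refine ContinuousMap.continuous_of_continuous_uncurry _ ?_
  rw [← (IsOpenQuotientMap.id.prodMap isOpenQuotientMap_coverMap).continuous_comp_iff]
  have : Continuous fun x : strip × ℂ => u (x.1.1.1 + x.2, x.1.1.2) :=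
    hu.1.continuousOn.comp_continuous (by fun_prop) fun x => mem_strip.2 (mem_strip.1 x.1.2)
  exact this.congr fun x => (hu.torusTranslate_apply x.1.2 x.2).symm

/-- Induction on the order: the partial derivatives of a periodic family are periodic families, and
their translates are the components of the derivative. -/
theorem contDiffOn_torusTranslate (hu : IsPeriodicFamily u) :
    ContDiffOn ℝ ∞ (torusTranslate u) strip := by
  rw [contDiffOn_infty]
  intro n
  induction n generalizing u with
  | zero => exact contDiffOn_zero.2 hu.continuousOn_torusTranslate
  | succ n ih =>
    let a : ℂ × ℝ →L[ℝ] ℝ := Complex.reCLM.comp (ContinuousLinearMap.fst ℝ ℂ ℝ)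
    let b : ℂ × ℝ →L[ℝ] ℝ := Complex.imCLM.comp (ContinuousLinearMap.fst ℝ ℂ ℝ)
    let c : ℂ × ℝ →L[ℝ] ℝ := ContinuousLinearMap.snd ℝ ℂ ℝ
    let U' : ℂ × ℝ → (ℂ × ℝ →L[ℝ] C(UnitAddTorus (Fin 2), ℂ)) := fun p =>
      a.smulRight (torusTranslate (_root_.stripDeriv (1, 0) u) p) +
      b.smulRight (torusTranslate (_root_.stripDeriv (Complex.I, 0) u) p) +
      c.smulRight (torusTranslate (_root_.stripDeriv (0, 1) u) p)
    have hU' : ContDiffOn ℝ n U' strip := by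
      have hs : ∀ (L : ℂ × ℝ →L[ℝ] ℝ) (v : ℂ × ℝ), ContDiffOn ℝ n
          (fun p => L.smulRight (torusTranslate (_root_.stripDeriv v u) p)) strip := fun L v =>
        contDiffOn_const.smulRight (ih (hu.stripDeriv v))
      exact ((hs a _).add (hs b _)).add (hs c _)
    rw [Nat.cast_add, Nat.cast_one]
    refine (contDiffOn_succ_iff_hasFDerivWithinAt (by simp)).2 fun p hp =>
      ⟨strip, by rw [insert_eq_of_mem hp]; exact self_mem_nhdsWithin, by simp, U', fun y hy => ?_,
        hU'⟩
    refine hasFDerivWithinAt_of_forall_eval convex_strip hU'.continuousOn (fun x y hy => ?_) hy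
    obtain ⟨z, rfl⟩ := isOpenQuotientMap_coverMap.surjective x
    have hyz : (y.1 + z, y.2) ∈ strip := mem_strip.2 (mem_strip.1 hy)
    have hcomp : HasFDerivWithinAt (fun p : ℂ × ℝ => u (p.1 + z, p.2))
        (fderivWithin ℝ u strip (y.1 + z, y.2)) strip y := by
      have hshift : HasFDerivAt (fun p : ℂ × ℝ => (p.1 + z, p.2)) (.id ℝ (ℂ × ℝ)) y :=
        ((hasFDerivAt_id y).add_const (z, 0)).congr_of_eventuallyEq
          (.of_forall fun p => by ext <;> simp)
      exact HasFDerivWithinAt.comp (t := strip) y (hu.1.hasFDerivWithinAt_strip hyz)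
        hshift.hasFDerivWithinAt (fun p hp => mem_strip.2 (mem_strip.1 hp))
    refine (hcomp.congr (fun p hp => hu.torusTranslate_apply hp z)
      (hu.torusTranslate_apply hy z)).congr_fderiv ?_
    refine ContinuousLinearMap.ext fun v => ?_
    have hv : v = v.1.re • ((1, 0) : ℂ × ℝ) + v.1.im • ((Complex.I, 0) : ℂ × ℝ) +
        v.2 • ((0, 1) : ℂ × ℝ) := by
      ext <;> simp
    conv_lhs => rw [hv]
    simp only [map_add, map_smul]
    simp [U', a, b, c, (hu.stripDeriv _).torusTranslate_apply hy, _root_.stripDeriv]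

theorem torusTranslate_eq (hu : IsPeriodicFamily u) {p : ℂ × ℝ} (hp : p ∈ strip)
    (x : UnitAddTorus (Fin 2)) :
    torusTranslate u p x = torusTranslate u (0, p.2) (x + coverMap p.1) := by
  obtain ⟨z, rfl⟩ := isOpenQuotientMap_coverMap.surjective x
  have hp0 : ((0 : ℂ), p.2) ∈ strip := mem_strip.2 (mem_strip.1 hp)
  rw [← coverMap_add, hu.torusTranslate_apply hp, hu.torusTranslate_apply hp0, zero_add, add_comm]

theorem norm_torusTranslate_lt (hu : IsPeriodicFamily u) {p : ℂ × ℝ} (hp : p ∈ strip) {C : ℝ}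
    (hC : 0 < C) (h : ∀ p ∈ strip, ‖u p‖ < C) : ‖torusTranslate u p‖ < C := by
  rw [ContinuousMap.norm_lt_iff _ hC]
  intro x
  obtain ⟨z, rfl⟩ := isOpenQuotientMap_coverMap.surjective x
  rw [hu.torusTranslate_apply hp]
  exact h _ (mem_strip.2 (mem_strip.1 hp))

end IsPeriodicFamily

theorem ContinuousMap.ext_coverMap {f g : C(UnitAddTorus (Fin 2), ℂ)}
    (h : ∀ z, f (coverMap z) = g (coverMap z)) : f = g := by
  ext x
  obtain ⟨z, rfl⟩ := isOpenQuotientMap_coverMap.surjective x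
  exact h z

/-! ### Fourier multipliers on `L²` and the Beltrami equation -/

section L2Torus

open MeasureTheory UnitAddTorus
open scoped ENNReal

/-- The measure on `ℝ / ℤ` is normalised to have total volume `1`. -/
noncomputable local instance normalizedMeasureSpace : MeasureSpace UnitAddCircle := ⟨AddCircle.haarAddCircle⟩

local instance : Measure.IsAddHaarMeasure (volume : Measure UnitAddCircle) :=
  inferInstanceAs (Measure.IsAddHaarMeasure AddCircle.haarAddCircle)

local instance : IsProbabilityMeasure (volume : Measure UnitAddCircle) :=
  inferInstanceAs (IsProbabilityMeasure AddCircle.haarAddCircle)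

section DiagonalOperator

variable {ι E : Type*} [NormedAddCommGroup E] [InnerProductSpace ℂ E]

/-- The operator that is diagonal in a Hilbert basis, with eigenvalues bounded by `1`. -/
noncomputable def HilbertBasis.diagonal (b : HilbertBasis ι ℂ E) (σ : ι → ℂ)
    (hσ : ∀ i, ‖σ i‖ ≤ 1) : E →L[ℂ] E :=
  have hle : ∀ (f : lp (fun _ : ι => ℂ) 2) i, ‖σ i * f i‖ ≤ ‖f i‖ := fun f i => by
    rw [norm_mul]
    exact mul_le_of_le_one_left (norm_nonneg _) (hσ i)
  LinearMap.mkContinuous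
    { toFun := fun x => b.repr.symm ⟨fun i => σ i * b.repr x i,
        (lp.memℓp (b.repr x)).mono' (hle (b.repr x))⟩
      map_add' := fun x y => by
        rw [← map_add]
        congr 1
        ext i
        rw [map_add]
        exact mul_add ..
      map_smul' := fun c x => by
        rw [RingHom.id_apply, ← map_smul]
        congr 1
        ext i
        rw [map_smul]
        exact mul_left_comm .. } 1 fun x => by
    rw [LinearMap.coe_mk, AddHom.coe_mk, LinearIsometryEquiv.norm_map, one_mul,
      ← b.repr.norm_map x]
    exact lp.norm_mono (by simp) (hle (b.repr x))

theorem HilbertBasis.repr_diagonal (b : HilbertBasis ι ℂ E) {σ : ι → ℂ} (hσ : ∀ i, ‖σ i‖ ≤ 1)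
    (x : E) (i : ι) : b.repr (b.diagonal σ hσ x) i = σ i * b.repr x i := by
  simp [HilbertBasis.diagonal]

theorem HilbertBasis.norm_diagonal_le (b : HilbertBasis ι ℂ E) {σ : ι → ℂ} (hσ : ∀ i, ‖σ i‖ ≤ 1) :
    ‖b.diagonal σ hσ‖ ≤ 1  := by
  unfold HilbertBasis.diagonal
  exact LinearMap.mkContinuous_norm_le _ zero_le_one _

end DiagonalOperator

/-- The Hilbert space `L²((ℝ/ℤ)²)`. -/
abbrev TorusL2 : Type := Lp ℂ 2 (volume : Measure (UnitAddTorus (Fin 2)))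

/-- A continuous function on the torus as an element of `L²`. -/
noncomputable def toL2 : C(UnitAddTorus (Fin 2), ℂ) →L[ℂ] TorusL2 := ContinuousMap.toLp 2 volume ℂ

theorem toL2_injective : Function.Injective toL2 := ContinuousMap.toLp_injective _

theorem denseRange_toL2 : DenseRange toL2 :=
  ContinuousMap.toLp_denseRange ℂ volume ℂ (by simp)

/-- The Fourier coefficients of an element of `L²`. -/
noncomputable def torusCoeff (n : Fin 2 → ℤ) : TorusL2 →L[ℂ] ℂ := innerSL ℂ (mFourierBasis n)

theorem torusCoeff_eq_repr (n : Fin 2 → ℤ) (f : TorusL2) :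
    torusCoeff n f = mFourierBasis.repr f n := by
  rw [HilbertBasis.repr_apply_apply]
  rfl

theorem TorusL2.ext_coeff {f g : TorusL2} (h : ∀ n, torusCoeff n f = torusCoeff n g) : f = g := by
  apply mFourierBasis.repr.injective
  ext n
  simpa only [torusCoeff_eq_repr] using h n

theorem torusCoeff_toL2 (n : Fin 2 → ℤ) (f : C(UnitAddTorus (Fin 2), ℂ)) :
    torusCoeff n (toL2 f) = ∫ x, mFourier (-n) x * f x := by
  rw [torusCoeff_eq_repr, mFourierBasis_repr, toL2, mFourierCoeff_toLp]
  rfl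

theorem torusCoeff_mFourier (n m : Fin 2 → ℤ) :
    torusCoeff n (toL2 (mFourier m)) = if n = m then 1 else 0 :=
  orthonormal_iff_ite.1 orthonormal_mFourier n m |> fun h => by
    rw [← h, torusCoeff, coe_mFourierBasis]; rfl

/-- Translation by `y` on `L²`. -/
noncomputable def translateL2 (y : UnitAddTorus (Fin 2)) : TorusL2 →L[ℂ] TorusL2 :=
  mFourierBasis.diagonal (fun n => mFourier n y)
    fun _ => (ContinuousMap.norm_coe_le_norm _ y).trans mFourier_norm.le

theorem torusCoeff_translateL2 (y : UnitAddTorus (Fin 2)) (n : Fin 2 → ℤ) (f : TorusL2) :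
    torusCoeff n (translateL2 y f) = mFourier n y * torusCoeff n f := by
  simp only [torusCoeff_eq_repr, translateL2, HilbertBasis.repr_diagonal]

theorem mFourier_apply_add (n : Fin 2 → ℤ) (x y : UnitAddTorus (Fin 2)) :
    mFourier n (x + y) = mFourier n x * mFourier n y := by
  simp only [mFourier, ContinuousMap.coe_mk, Pi.add_apply, fourier_apply, smul_add,
    AddCircle.toCircle_add, Circle.coe_mul, Finset.prod_mul_distrib]

/-- Invariance of Haar measure identifies the Fourier multiplier with actual translation. -/
theorem translateL2_toL2 (y : UnitAddTorus (Fin 2)) {f g : C(UnitAddTorus (Fin 2), ℂ)}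
    (h : ∀ x, g x = f (x + y)) : translateL2 y (toL2 f) = toL2 g := by
  refine TorusL2.ext_coeff fun n => ?_
  rw [torusCoeff_translateL2, torusCoeff_toL2, torusCoeff_toL2,
    ← integral_add_right_eq_self (fun x => mFourier (-n) x * f x) y, ← integral_const_mul]
  refine integral_congr_ae (.of_forall fun x => ?_)
  have h1 : mFourier n y * mFourier (-n) y = 1 := by
    rw [← mFourier_add, add_neg_cancel, mFourier_zero]
    rfl
  simp only [h, mFourier_apply_add]
  linear_combination (mFourier (-n) x * f (x + y)) * h1

/-- The action of continuous functions on `L²` by multiplication. -/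
noncomputable def mulL2 : C(UnitAddTorus (Fin 2), ℂ) →L[ℂ] TorusL2 →L[ℂ] TorusL2 :=
  ((ContinuousLinearMap.mul ℂ ℂ).holderL (volume : Measure (UnitAddTorus (Fin 2))) ∞ 2 2).comp
    (ContinuousMap.toLp ∞ volume ℂ)

theorem mulL2_toL2 (u f : C(UnitAddTorus (Fin 2), ℂ)) : mulL2 u (toL2 f) = toL2 (u * f) := by
  apply Lp.ext
  have h1 := (ContinuousLinearMap.mul ℂ ℂ).coeFn_holder (r := 2)
    (ContinuousMap.toLp ∞ volume ℂ u) (toL2 f)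
  filter_upwards [h1, ContinuousMap.coeFn_toLp (p := ∞) volume u (𝕜 := ℂ),
    ContinuousMap.coeFn_toLp (p := 2) volume f (𝕜 := ℂ),
    ContinuousMap.coeFn_toLp (p := 2) volume (u * f) (𝕜 := ℂ)] with x hx h2 h3 h4
  refine hx.trans ?_
  rw [ContinuousLinearMap.mul_apply', h2, toL2, h3, h4]
  rfl

theorem norm_mulL2_le (u : C(UnitAddTorus (Fin 2), ℂ)) : ‖mulL2 u‖ ≤ ‖u‖ := by
  have h1 : ‖(ContinuousLinearMap.mul ℂ ℂ).holderL
      (volume : Measure (UnitAddTorus (Fin 2))) ∞ 2 2‖ ≤ 1 :=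
    (ContinuousLinearMap.norm_holderL_le ..).trans (ContinuousLinearMap.opNorm_mul_le ℂ ℂ)
  have h2 : ‖ContinuousMap.toLp (E := ℂ) ∞ (volume : Measure (UnitAddTorus (Fin 2))) ℂ u‖ ≤ ‖u‖ := by
    refine (ContinuousLinearMap.le_opNorm _ _).trans
      (mul_le_of_le_one_left (norm_nonneg _) ((ContinuousMap.toLp_norm_le ..).trans ?_))
    simp
  change ‖(ContinuousLinearMap.mul ℂ ℂ).holderL volume ∞ 2 2 (ContinuousMap.toLp ∞ volume ℂ u)‖ ≤ _
  refine (ContinuousLinearMap.le_opNorm _ _).trans ?_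
  exact (mul_le_of_le_one_left (norm_nonneg _) h1).trans h2

theorem translateL2_mulL2 (y : UnitAddTorus (Fin 2)) {u w : C(UnitAddTorus (Fin 2), ℂ)}
    (h : ∀ x, w x = u (x + y)) (f : TorusL2) :
    translateL2 y (mulL2 u f) = mulL2 w (translateL2 y f) := by
  refine congrFun (DenseRange.equalizer denseRange_toL2
    (g := fun f => translateL2 y (mulL2 u f)) (h := fun f => mulL2 w (translateL2 y f))
    (by fun_prop) (by fun_prop) (funext fun g => ?_)) f
  have hg := translateL2_toL2 y (f := g) (g := g.comp ⟨fun x => x + y, by fun_prop⟩) fun x => rfl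
  simp only [Function.comp_apply, mulL2_toL2, hg]
  exact translateL2_toL2 y fun x => by simp [h]

/-- The symbol of `∂_z`: `∂_z` acts on the `n`-th Fourier mode by this scalar. -/
noncomputable def dzSymbol (n : Fin 2 → ℤ) : ℂ := Complex.I / 2 * (n 0 - n 1 * Complex.I)

/-- The symbol of `∂_z̄`. -/
noncomputable def dzbarSymbol (n : Fin 2 → ℤ) : ℂ := Complex.I / 2 * (n 0 + n 1 * Complex.I)

theorem norm_dzSymbol (n : Fin 2 → ℤ) : ‖dzSymbol n‖ = ‖dzbarSymbol n‖ := by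
  have : (n 0 - n 1 * Complex.I : ℂ) = (starRingEnd ℂ) (n 0 + n 1 * Complex.I) := by
    simp [sub_eq_add_neg]
  rw [dzSymbol, dzbarSymbol, norm_mul, norm_mul, this, Complex.norm_conj]

theorem dzbarSymbol_eq_zero_iff {n : Fin 2 → ℤ} : dzbarSymbol n = 0 ↔ n = 0 := by
  refine ⟨fun h => ?_, by rintro rfl; simp [dzbarSymbol]⟩
  have h' : (n 0 + n 1 * Complex.I : ℂ) = 0 := by
    simpa [dzbarSymbol] using h
  have h0 := congrArg Complex.re h'
  have h1 := congrArg Complex.im h'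
  simp at h0 h1
  funext i
  fin_cases i <;> simp [h0, h1]

/-- The operator `∂_z ∂_z̄⁻¹` on `L²`, which is unitary on the functions of mean zero. -/
noncomputable def beurling : TorusL2 →L[ℂ] TorusL2 :=
  mFourierBasis.diagonal (fun n => dzSymbol n / dzbarSymbol n) fun n => by
    -- At `n = 0` the quotient is `0 / 0 = 0`, so constants are killed.
    rw [norm_div, norm_dzSymbol]
    exact div_self_le_one _

theorem torusCoeff_beurling (n : Fin 2 → ℤ) (f : TorusL2) :
    torusCoeff n (beurling f) = dzSymbol n / dzbarSymbol n * torusCoeff n f := by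
  simp only [torusCoeff_eq_repr, beurling, HilbertBasis.repr_diagonal]

theorem norm_beurling_le : ‖beurling‖ ≤ 1 := HilbertBasis.norm_diagonal_le ..

theorem translateL2_beurling (y : UnitAddTorus (Fin 2)) (f : TorusL2) :
    translateL2 y (beurling f) = beurling (translateL2 y f) := by
  refine TorusL2.ext_coeff fun n => ?_
  simp only [torusCoeff_translateL2, torusCoeff_beurling]
  ring

theorem norm_mulL2_mul_beurling_lt {u : C(UnitAddTorus (Fin 2), ℂ)} (hu : ‖u‖ < 1) :
    ‖mulL2 u * beurling‖ < 1 :=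
  ((norm_mul_le _ _).trans
    (mul_le_of_le_one_right (norm_nonneg _) norm_beurling_le)).trans_lt
    ((norm_mulL2_le u).trans_lt hu)

/-- The solution `ψ` of `ψ - u ∂_z ∂_z̄⁻¹ ψ = w` in `L²`. -/
noncomputable def beltramiSolve (u w : C(UnitAddTorus (Fin 2), ℂ)) : TorusL2 :=
  Ring.inverse (1 - mulL2 u * beurling) (toL2 w)

theorem eq_beltramiSolve {u w : C(UnitAddTorus (Fin 2), ℂ)} (hu : ‖u‖ < 1) {ψ : TorusL2}
    (h : ψ - mulL2 u (beurling ψ) = toL2 w) : ψ = beltramiSolve u w := by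
  have hunit := isUnit_one_sub_of_norm_lt_one (norm_mulL2_mul_beurling_lt hu)
  have h' : (1 - mulL2 u * beurling) ψ = toL2 w := h
  rw [beltramiSolve, ← h', ← mul_apply_eq_comp, Ring.inverse_mul_cancel _ hunit]
  rfl

theorem beltramiSolve_sub {u w : C(UnitAddTorus (Fin 2), ℂ)} (hu : ‖u‖ < 1) :
    beltramiSolve u w - mulL2 u (beurling (beltramiSolve u w)) = toL2 w := by
  have hunit := isUnit_one_sub_of_norm_lt_one (norm_mulL2_mul_beurling_lt hu)
  change (1 - mulL2 u * beurling) (Ring.inverse (1 - mulL2 u * beurling) (toL2 w)) = toL2 w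
  rw [← mul_apply_eq_comp, Ring.mul_inverse_cancel _ hunit]
  rfl

/-- Inversion is smooth at units of the algebra of bounded operators, and everything else is linear
or bilinear. -/
theorem contDiffOn_beltramiSolve {E : Type*} [NormedAddCommGroup E] [NormedSpace ℝ E] {D : Set E}
    {u w : E → C(UnitAddTorus (Fin 2), ℂ)} (hu : ContDiffOn ℝ ∞ u D) (hw : ContDiffOn ℝ ∞ w D)
    (hlt : ∀ p ∈ D, ‖u p‖ < 1) : ContDiffOn ℝ ∞ (fun p => beltramiSolve (u p) (w p)) D := by
  have h1 : ContDiffOn ℝ ∞ (fun p => 1 - mulL2 (u p) * beurling) D :=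
    contDiffOn_const.sub (((mulL2.restrictScalars ℝ).contDiff.comp_contDiffOn hu).mul
      contDiffOn_const)
  have h2 : ContDiffOn ℝ ∞ (fun p => Ring.inverse (1 - mulL2 (u p) * beurling)) D := by
    intro p hp
    obtain ⟨U, hU⟩ := isUnit_one_sub_of_norm_lt_one (norm_mulL2_mul_beurling_lt (hlt p hp))
    have := contDiffAt_ringInverse ℝ (n := ∞) U
    rw [hU] at this
    exact this.comp_contDiffWithinAt p (h1 p hp)
  exact ContDiffOn.clm_apply
    ((ContinuousLinearMap.restrictScalarsL ℂ TorusL2 TorusL2 ℝ ℝ).contDiff.comp_contDiffOn h2)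
    ((toL2.restrictScalars ℝ).contDiff.comp_contDiffOn hw)

end L2Torus

/-! ### Translation orbits in `L²` and their Fourier coefficients -/

section Equivariant

open UnitAddTorus

/-- The operator `∂_z` on families. -/
noncomputable def familyDz (u : ℂ × ℝ → ℂ) : ℂ × ℝ → ℂ := fun p =>
  1 / 2 * (stripDeriv (1, 0) u p - Complex.I * stripDeriv (Complex.I, 0) u p)

/-- The operator `∂_z̄` on families. -/
noncomputable def familyDzbar (u : ℂ × ℝ → ℂ) : ℂ × ℝ → ℂ := fun p =>
  1 / 2 * (stripDeriv (1, 0) u p + Complex.I * stripDeriv (Complex.I, 0) u p)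

theorem IsPeriodicFamily.familyDz {u : ℂ × ℝ → ℂ} (hu : IsPeriodicFamily u) :
    IsPeriodicFamily (familyDz u) :=
  ((hu.stripDeriv _).sub ((hu.stripDeriv _).const_mul _)).const_mul _

theorem IsPeriodicFamily.familyDzbar {u : ℂ × ℝ → ℂ} (hu : IsPeriodicFamily u) :
    IsPeriodicFamily (familyDzbar u) :=
  ((hu.stripDeriv _).add ((hu.stripDeriv _).const_mul _)).const_mul _

/-- The symbol of the derivative in direction `v`. -/
noncomputable def dirSymbol (n : Fin 2 → ℤ) (v : ℂ) : ℂ :=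
  Complex.I * (n 0 * v.re + n 1 * v.im)

/-- A smooth `L²`-valued map on the strip, at each time equal to the orbit of one element under
translations. -/
structure IsEquivariantFamily (Ω : ℂ × ℝ → TorusL2) : Prop where
  contDiffOn : ContDiffOn ℝ ∞ Ω strip
  coeff_eq : ∀ n, ∀ p ∈ strip,
    torusCoeff n (Ω p) = mFourier n (coverMap p.1) * torusCoeff n (Ω (0, p.2))

namespace IsEquivariantFamily

variable {Ω Ω' : ℂ × ℝ → TorusL2}

theorem add (h : IsEquivariantFamily Ω) (h' : IsEquivariantFamily Ω') :
    IsEquivariantFamily fun p => Ω p + Ω' p :=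
  ⟨h.1.add h'.1, fun n p hp => by simp only [map_add, mul_add, ← h.2 n p hp, ← h'.2 n p hp]⟩

theorem coeff_add (h : IsEquivariantFamily Ω) {p : ℂ × ℝ} (hp : p ∈ strip) (z : ℂ)
    (n : Fin 2 → ℤ) :
    torusCoeff n (Ω (p.1 + z, p.2)) = mFourier n (coverMap z) * torusCoeff n (Ω p) := by
  rw [h.2 n (p.1 + z, p.2) (mem_strip.2 (mem_strip.1 hp)), h.2 n p hp, coverMap_add,
    mFourier_apply_add]
  ring

/-- Along an orbit each coefficient is a fixed exponential in the space variable times a constant.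
-/
theorem coeff_stripDeriv (h : IsEquivariantFamily Ω) {p : ℂ × ℝ} (hp : p ∈ strip)
    (n : Fin 2 → ℤ) (v : ℂ) :
    torusCoeff n (stripDeriv (v, 0) Ω p) = dirSymbol n v * torusCoeff n (Ω p) := by
  let A : ℂ →L[ℝ] ℂ := Complex.I • ((n 0 : ℂ) • (Complex.ofRealCLM.comp Complex.reCLM) +
    (n 1 : ℂ) • (Complex.ofRealCLM.comp Complex.imCLM))
  have h1 : HasFDerivAt (fun z => torusCoeff n (Ω (z, p.2)))
      (((torusCoeff n).restrictScalars ℝ).comp ((fderivWithin ℝ Ω strip p).comp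
        (ContinuousLinearMap.inl ℝ ℂ ℝ))) p.1 :=
    ((torusCoeff n).restrictScalars ℝ).hasFDerivAt.comp p.1 (hasFDerivAt_slice h.1 hp)
  have h2 : (fun z => torusCoeff n (Ω (z, p.2))) =
      fun z => Complex.exp (A z) * torusCoeff n (Ω (0, p.2)) := by
    funext z
    rw [h.2 n (z, p.2) (mem_strip.2 (mem_strip.1 hp)), mFourier_coverMap]
    simp [A, mul_add]
  have h3 := (A.hasFDerivAt (x := p.1)).cexp.mul_const (torusCoeff n (Ω (0, p.2)))
  rw [h2] at h1
  have h4 := congrArg (fun B : ℂ →L[ℝ] ℂ => B v) (h1.unique h3)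
  have h5 := congrFun h2 p.1
  have h6 : torusCoeff n (stripDeriv (v, 0) Ω p) =
      torusCoeff n (Ω (0, p.2)) * (Complex.exp (A p.1) * A v) := by
    simpa [stripDeriv] using h4
  rw [h6, h5]
  simp only [A, dirSymbol, _root_.smul_apply, _root_.add_apply,
    ContinuousLinearMap.comp_apply, Complex.ofRealCLM_apply, Complex.reCLM_apply,
    Complex.imCLM_apply, smul_eq_mul]
  ring

theorem stripDeriv (h : IsEquivariantFamily Ω) (v : ℂ) :
    IsEquivariantFamily (stripDeriv (v, 0) Ω) :=
  ⟨contDiffOn_stripDeriv h.1 _, fun n p hp => by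
    rw [h.coeff_stripDeriv hp, h.coeff_stripDeriv (p := (0, p.2)) (mem_strip.2 (mem_strip.1 hp)),
      h.2 n p hp]
    ring⟩

end IsEquivariantFamily

namespace IsPeriodicFamily

variable {u w : ℂ × ℝ → ℂ}

theorem torusTranslate_add (hu : IsPeriodicFamily u) (hw : IsPeriodicFamily w) {p : ℂ × ℝ}
    (hp : p ∈ strip) :
    torusTranslate (fun p => u p + w p) p = torusTranslate u p + torusTranslate w p :=
  ContinuousMap.ext_coverMap fun z => by
    simp [hu.torusTranslate_apply hp, hw.torusTranslate_apply hp,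
      (hu.add hw).torusTranslate_apply hp]

theorem torusTranslate_sub (hu : IsPeriodicFamily u) (hw : IsPeriodicFamily w) {p : ℂ × ℝ}
    (hp : p ∈ strip) :
    torusTranslate (fun p => u p - w p) p = torusTranslate u p - torusTranslate w p :=
  ContinuousMap.ext_coverMap fun z => by
    simp [hu.torusTranslate_apply hp, hw.torusTranslate_apply hp,
      (hu.sub hw).torusTranslate_apply hp]

theorem torusTranslate_mul (hu : IsPeriodicFamily u) (hw : IsPeriodicFamily w) {p : ℂ × ℝ}
    (hp : p ∈ strip) :
    torusTranslate (fun p => u p * w p) p = torusTranslate u p * torusTranslate w p :=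
  ContinuousMap.ext_coverMap fun z => by
    simp [hu.torusTranslate_apply hp, hw.torusTranslate_apply hp,
      (hu.mul hw).torusTranslate_apply hp]

theorem torusTranslate_const_mul (c : ℂ) (hu : IsPeriodicFamily u) {p : ℂ × ℝ}
    (hp : p ∈ strip) : torusTranslate (fun p => c * u p) p = c • torusTranslate u p :=
  ContinuousMap.ext_coverMap fun z => by
    simp [hu.torusTranslate_apply hp, (hu.const_mul c).torusTranslate_apply hp]

theorem isEquivariantFamily (hu : IsPeriodicFamily u) :
    IsEquivariantFamily fun p => toL2 (torusTranslate u p) := by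
  refine ⟨(toL2.restrictScalars ℝ).contDiff.comp_contDiffOn hu.contDiffOn_torusTranslate,
    fun n p hp => ?_⟩
  rw [← torusCoeff_translateL2, translateL2_toL2 (coverMap p.1) (hu.torusTranslate_eq hp)]

theorem stripDeriv_toL2 (hu : IsPeriodicFamily u) (v : ℂ × ℝ) {p : ℂ × ℝ} (hp : p ∈ strip) :
    _root_.stripDeriv v (fun p => toL2 (torusTranslate u p)) p =
      toL2 (torusTranslate (_root_.stripDeriv v u) p) := by
  have h1 := hu.contDiffOn_torusTranslate.hasFDerivWithinAt_strip hp
  have h2 : HasFDerivWithinAt (fun p => toL2 (torusTranslate u p)) _ strip p :=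
    (toL2.restrictScalars ℝ).hasFDerivAt.comp_hasFDerivWithinAt p h1
  rw [_root_.stripDeriv, h2.fderivWithin (uniqueDiffOn_strip p hp)]
  change toL2 (fderivWithin ℝ (torusTranslate u) strip p v) = _
  congr 1
  refine ContinuousMap.ext_coverMap fun z => ?_
  have hpz : (p.1 + z, p.2) ∈ strip := mem_strip.2 (mem_strip.1 hp)
  let ev : C(UnitAddTorus (Fin 2), ℂ) →L[ℝ] ℂ := ContinuousMap.evalCLM ℝ (coverMap z)
  have h3 : HasFDerivWithinAt (fun p => torusTranslate u p (coverMap z))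
      (ev.comp (fderivWithin ℝ (torusTranslate u) strip p)) strip p :=
    ev.hasFDerivAt.comp_hasFDerivWithinAt p h1
  have hshift : HasFDerivAt (fun p : ℂ × ℝ => (p.1 + z, p.2)) (.id ℝ (ℂ × ℝ)) p :=
    ((hasFDerivAt_id p).add_const (z, 0)).congr_of_eventuallyEq
      (.of_forall fun p => by ext <;> simp)
  have h4 := HasFDerivWithinAt.comp (t := strip) p (hu.1.hasFDerivWithinAt_strip hpz)
    hshift.hasFDerivWithinAt (fun p hp => mem_strip.2 (mem_strip.1 hp))
  have h5 := h3.congr (fun q hq => (hu.torusTranslate_apply hq z).symm)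
    (hu.torusTranslate_apply hp z).symm
  have h6 := (uniqueDiffOn_strip p hp).eq h5 h4
  have h7 := congrArg (fun B : ℂ × ℝ →L[ℝ] ℂ => B v) h6
  rw [(hu.stripDeriv v).torusTranslate_apply hp]
  simpa [_root_.stripDeriv, ev] using h7

theorem coeff_stripDeriv (hu : IsPeriodicFamily u) {p : ℂ × ℝ} (hp : p ∈ strip) (n : Fin 2 → ℤ)
    (v : ℂ) :
    torusCoeff n (toL2 (torusTranslate (_root_.stripDeriv (v, 0) u) p)) =
      dirSymbol n v * torusCoeff n (toL2 (torusTranslate u p)) := by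
  rw [← hu.stripDeriv_toL2 (v, 0) hp, hu.isEquivariantFamily.coeff_stripDeriv hp]

theorem coeff_familyDz (hu : IsPeriodicFamily u) {p : ℂ × ℝ} (hp : p ∈ strip) (n : Fin 2 → ℤ) :
    torusCoeff n (toL2 (torusTranslate (_root_.familyDz u) p)) =
      dzSymbol n * torusCoeff n (toL2 (torusTranslate u p)) := by
  have h1 := hu.stripDeriv (1, 0)
  have hI := hu.stripDeriv (Complex.I, 0)
  unfold _root_.familyDz
  rw [torusTranslate_const_mul _ (h1.sub (hI.const_mul _)) hp,
    torusTranslate_sub h1 (hI.const_mul _) hp, torusTranslate_const_mul _ hI hp]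
  simp only [map_smul, map_sub, hu.coeff_stripDeriv hp, smul_eq_mul, dirSymbol, dzSymbol,
    Complex.one_re, Complex.one_im, Complex.I_re, Complex.I_im, Complex.ofReal_zero,
    Complex.ofReal_one]
  ring

theorem coeff_familyDzbar (hu : IsPeriodicFamily u) {p : ℂ × ℝ} (hp : p ∈ strip)
    (n : Fin 2 → ℤ) :
    torusCoeff n (toL2 (torusTranslate (_root_.familyDzbar u) p)) =
      dzbarSymbol n * torusCoeff n (toL2 (torusTranslate u p)) := by
  have h1 := hu.stripDeriv (1, 0)
  have hI := hu.stripDeriv (Complex.I, 0)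
  unfold _root_.familyDzbar
  rw [torusTranslate_const_mul _ (h1.add (hI.const_mul _)) hp,
    torusTranslate_add h1 (hI.const_mul _) hp, torusTranslate_const_mul _ hI hp]
  simp only [map_smul, map_add, hu.coeff_stripDeriv hp, smul_eq_mul, dirSymbol, dzbarSymbol,
    Complex.one_re, Complex.one_im, Complex.I_re, Complex.I_im, Complex.ofReal_zero,
    Complex.ofReal_one]
  ring

end IsPeriodicFamily

namespace IsEquivariantFamily

variable {Ω : ℂ × ℝ → TorusL2}

/-- This passes from smooth orbits in `L²` to smooth functions: a bounded functional preserves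
smoothness. -/
theorem isPeriodicFamily_inner (h : IsEquivariantFamily Ω) (η : TorusL2) :
    IsPeriodicFamily fun p => innerSL ℂ η (Ω p) := by
  refine ⟨((innerSL ℂ η).restrictScalars ℝ).contDiff.comp_contDiffOn h.1, fun l hl z t ht => ?_⟩
  refine congrArg _ (TorusL2.ext_coeff fun n => ?_)
  rw [h.2 n (z + l, t) (mem_strip.2 ht), h.2 n (z, t) (mem_strip.2 ht), coverMap_add_period hl]

/-- Pairing an orbit with `η` is a convolution. A product of two square-summable sequences is
summable, so the Fourier series converges uniformly and its coefficients can be read off termwise.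
-/
theorem coeff_inner (h : IsEquivariantFamily Ω) (η : TorusL2) {p : ℂ × ℝ} (hp : p ∈ strip)
    (n : Fin 2 → ℤ) :
    torusCoeff n (toL2 (torusTranslate (fun p => innerSL ℂ η (Ω p)) p)) =
      starRingEnd ℂ (torusCoeff n η) * torusCoeff n (Ω p) := by
  let c : (Fin 2 → ℤ) → ℂ := fun n => starRingEnd ℂ (torusCoeff n η) * torusCoeff n (Ω p)
  have hsum : ∀ x : TorusL2, HasSum (fun n => starRingEnd ℂ (torusCoeff n η) * torusCoeff n x)
      (innerSL ℂ η x) := fun x => by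
    refine (mFourierBasis.hasSum_inner_mul_inner η x).congr_fun fun n => ?_
    simp [torusCoeff]
  have hG : Summable fun n => c n • (mFourier n : C(UnitAddTorus (Fin 2), ℂ)) := by
    refine Summable.of_norm ?_
    simpa only [norm_smul, mFourier_norm, mul_one] using (hsum (Ω p)).summable.norm
  have hEq : torusTranslate (fun p => innerSL ℂ η (Ω p)) p = ∑' n, c n • mFourier n := by
    refine ContinuousMap.ext_coverMap fun z => ?_
    rw [(h.isPeriodicFamily_inner η).torusTranslate_apply hp]
    have h1 := (ContinuousMap.evalCLM ℂ (coverMap z)).hasSum hG.hasSum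
    refine (hsum (Ω (p.1 + z, p.2))).unique (h1.congr_fun fun n => ?_)
    rw [h.coeff_add hp]
    simp [c]
    ring
  rw [hEq]
  have h2 := ((torusCoeff n).comp toL2).hasSum hG.hasSum
  refine h2.unique ((hasSum_ite_eq n (c n)).congr_fun fun m => ?_)
  by_cases hm : m = n
  · simp [torusCoeff_mFourier, hm]
  · simp [torusCoeff_mFourier, hm, Ne.symm hm]

end IsEquivariantFamily

end Equivariant

/-! ### Solving for the potential up to a constant -/

section Beltrami

open UnitAddTorus

/-- The symbol of the Laplacian. -/
noncomputable def laplaceSymbol (n : Fin 2 → ℤ) : ℂ := -((n 0 : ℂ) ^ 2 + (n 1 : ℂ) ^ 2)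

theorem norm_sq_le_add_sq (n : Fin 2 → ℤ) : ‖n‖ ^ 2 ≤ (n 0 : ℝ) ^ 2 + (n 1 : ℝ) ^ 2 := by
  have h : ‖n‖ ≤ √((n 0 : ℝ) ^ 2 + (n 1 : ℝ) ^ 2) := by
    rw [pi_norm_le_iff_of_nonneg (Real.sqrt_nonneg _)]
    intro i
    rw [← Int.norm_cast_real, Real.norm_eq_abs]
    fin_cases i
    · exact Real.abs_le_sqrt (by simp; positivity)
    · exact Real.abs_le_sqrt (by simp; positivity)
  calc ‖n‖ ^ 2 ≤ √((n 0 : ℝ) ^ 2 + (n 1 : ℝ) ^ 2) ^ 2 := by gcongr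
    _ = _ := Real.sq_sqrt (by positivity)

theorem norm_laplaceSymbol (n : Fin 2 → ℤ) :
    ‖laplaceSymbol n‖ = (n 0 : ℝ) ^ 2 + (n 1 : ℝ) ^ 2 := by
  rw [laplaceSymbol, norm_neg]
  have : ((n 0 : ℂ) ^ 2 + (n 1 : ℂ) ^ 2) = (((n 0 : ℝ) ^ 2 + (n 1 : ℝ) ^ 2 : ℝ) : ℂ) := by
    push_cast
    rfl
  rw [this, Complex.norm_real, Real.norm_of_nonneg (by positivity)]

theorem laplaceSymbol_eq (n : Fin 2 → ℤ) : laplaceSymbol n = 4 * (dzSymbol n * dzbarSymbol n) := by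
  simp only [laplaceSymbol, dzSymbol, dzbarSymbol]
  linear_combination (-(n 0 : ℂ) ^ 2 + (n 1 : ℂ) ^ 2 * (Complex.I ^ 2 - 1)) * Complex.I_sq

theorem norm_le_two_mul_norm_dzbarSymbol (n : Fin 2 → ℤ) : ‖n‖ ≤ 2 * ‖dzbarSymbol n‖ := by
  have h := norm_sq_le_add_sq n
  rw [← norm_laplaceSymbol, laplaceSymbol_eq, norm_mul, norm_mul, norm_dzSymbol] at h
  have h4 : ‖(4 : ℂ)‖ = 4 := by simp
  rw [h4] at h
  nlinarith [norm_nonneg n, norm_nonneg (dzbarSymbol n)]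

/-- The symbol of the inverse of `Δ ∂_z̄` on functions of mean zero. -/
noncomputable def kernelSymbol (n : Fin 2 → ℤ) : ℂ := (dzbarSymbol n * laplaceSymbol n)⁻¹

/-- The symbol is at most `2 ‖n‖⁻³` away from `n = 0`; its square is dominated by `4 ‖n‖⁻⁶`,
summable over `ℤ²`. -/
theorem memlp_kernelSymbol : Memℓp (fun n => starRingEnd ℂ (kernelSymbol n)) 2 := by
  refine memℓp_gen ?_
  have h6 := (EisensteinSeries.summable_one_div_norm_rpow (k := 6) (by norm_num)).mul_left 4
  refine Summable.of_nonneg_of_le (fun n => by positivity) (fun n => ?_) h6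
  simp only [RCLike.norm_conj, ENNReal.toReal_ofNat, Real.rpow_ofNat, kernelSymbol, norm_inv,
    norm_mul]
  rcases eq_or_ne n 0 with rfl | hn
  · simp [dzbarSymbol]
  · have hpos : 0 < ‖n‖ := norm_pos_iff.2 hn
    rw [Real.rpow_neg hpos.le]
    have h1 := norm_le_two_mul_norm_dzbarSymbol n
    have h2 := norm_sq_le_add_sq n
    rw [← norm_laplaceSymbol] at h2
    have h3 : ‖n‖ ^ 3 / 2 ≤ ‖dzbarSymbol n‖ * ‖laplaceSymbol n‖ := by
      calc ‖n‖ ^ 3 / 2 = (‖n‖ / 2) * ‖n‖ ^ 2 := by ring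
        _ ≤ _ := mul_le_mul (by linarith) h2 (by positivity) (norm_nonneg _)
    calc (‖dzbarSymbol n‖ * ‖laplaceSymbol n‖)⁻¹ ^ 2 ≤ (‖n‖ ^ 3 / 2)⁻¹ ^ 2 := by gcongr
      _ = 4 * (‖n‖ ^ (6 : ℝ))⁻¹ := by
        rw [show (6 : ℝ) = ((6 : ℕ) : ℝ) by norm_num, Real.rpow_natCast]
        field_simp
        norm_num

/-- For a family of Beltrami coefficients `ν`, the equation `φ_z̄ - ν φ_z = ν_z` on the torus can be
solved by a smooth family, up to a constant at each time. -/
theorem exists_beltrami_potential {ν : ℂ × ℝ → ℂ} (hν : IsPeriodicFamily ν)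
    (hlt : ∀ p ∈ strip, ‖ν p‖ < 1) :
    ∃ φ, IsPeriodicFamily φ ∧ ∀ p ∈ strip, familyDzbar φ p - ν p * familyDz φ p - familyDz ν p =
      -torusCoeff 0 (beltramiSolve (torusTranslate ν (0, p.2))
        (torusTranslate (familyDz ν) (0, p.2))) := by
  let Ψ : ℂ × ℝ → TorusL2 := fun p =>
    beltramiSolve (torusTranslate ν p) (torusTranslate (familyDz ν) p)
  have hnorm : ∀ p ∈ strip, ‖torusTranslate ν p‖ < 1 := fun p hp =>
    hν.norm_torusTranslate_lt hp one_pos hlt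
  have hsolve : ∀ p ∈ strip, Ψ p - mulL2 (torusTranslate ν p) (beurling (Ψ p)) =
      toL2 (torusTranslate (familyDz ν) p) := fun p hp => beltramiSolve_sub (hnorm p hp)
  have hΨ : IsEquivariantFamily Ψ := by
    refine ⟨contDiffOn_beltramiSolve hν.contDiffOn_torusTranslate
      hν.familyDz.contDiffOn_torusTranslate hnorm, fun n p hp => ?_⟩
    have hp0 : ((0 : ℂ), p.2) ∈ strip := mem_strip.2 (mem_strip.1 hp)
    rw [← torusCoeff_translateL2]
    congr 1
    -- The translated solution solves the translated equation, so uniqueness gives equivariance.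
    refine (eq_beltramiSolve (hnorm p hp) ?_).symm
    rw [← translateL2_beurling, ← translateL2_mulL2 (coverMap p.1) (hν.torusTranslate_eq hp),
      ← map_sub, hsolve _ hp0]
    exact translateL2_toL2 _ (hν.familyDz.torusTranslate_eq hp)
  -- `Ω = ΔΨ`. The symbol of `∂_z̄⁻¹` is not square-summable in dimension two, whereas that of `(Δ
  -- ∂_z̄)⁻¹` is; the smooth orbit can afford the extra Laplacian.
  let Ω : ℂ × ℝ → TorusL2 := fun p => stripDeriv (1, 0) (stripDeriv (1, 0) Ψ) p +
    stripDeriv (Complex.I, 0) (stripDeriv (Complex.I, 0) Ψ) p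
  have hΩ : IsEquivariantFamily Ω :=
    ((hΨ.stripDeriv _).stripDeriv _).add ((hΨ.stripDeriv _).stripDeriv _)
  have hΩcoeff : ∀ p ∈ strip, ∀ n, torusCoeff n (Ω p) = laplaceSymbol n * torusCoeff n (Ψ p) := by
    intro p hp n
    simp only [Ω, map_add, (hΨ.stripDeriv _).coeff_stripDeriv hp, hΨ.coeff_stripDeriv hp,
      dirSymbol, laplaceSymbol, Complex.one_re, Complex.one_im, Complex.I_re, Complex.I_im,
      Complex.ofReal_zero, Complex.ofReal_one]
    linear_combination ((n 0 : ℂ) ^ 2 + (n 1 : ℂ) ^ 2) * torusCoeff n (Ψ p) * Complex.I_sq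
  let η : TorusL2 := mFourierBasis.repr.symm ⟨_, memlp_kernelSymbol⟩
  have hη : ∀ n, starRingEnd ℂ (torusCoeff n η) = kernelSymbol n := fun n => by
    simp [torusCoeff_eq_repr, η]
  let φ : ℂ × ℝ → ℂ := fun p => innerSL ℂ η (Ω p)
  have hφ : IsPeriodicFamily φ := hΩ.isPeriodicFamily_inner η
  have hφcoeff : ∀ p ∈ strip, ∀ n, torusCoeff n (toL2 (torusTranslate φ p)) =
      (dzbarSymbol n)⁻¹ * torusCoeff n (Ψ p) := by
    intro p hp n
    rw [hΩ.coeff_inner η hp, hη, hΩcoeff p hp, kernelSymbol]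
    rcases eq_or_ne n 0 with rfl | hn
    · simp [dzbarSymbol]
    · have h1 : dzbarSymbol n ≠ 0 := dzbarSymbol_eq_zero_iff.not.2 hn
      have h2 : laplaceSymbol n ≠ 0 := by
        rw [laplaceSymbol_eq]
        have : dzSymbol n ≠ 0 := by rwa [← norm_ne_zero_iff, norm_dzSymbol, norm_ne_zero_iff]
        simp [this, h1]
      field_simp
  refine ⟨φ, hφ, fun p hp => ?_⟩
  have hp0 : ((0 : ℂ), p.2) ∈ strip := mem_strip.2 (mem_strip.1 hp)
  have hz : toL2 (torusTranslate (familyDz φ) p) = beurling (Ψ p) := by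
    refine TorusL2.ext_coeff fun n => ?_
    rw [hφ.coeff_familyDz hp, hφcoeff p hp, torusCoeff_beurling]
    ring
  have hzbar : toL2 (torusTranslate (familyDzbar φ) p) =
      Ψ p - torusCoeff 0 (Ψ p) • toL2 (mFourier 0) := by
    refine TorusL2.ext_coeff fun n => ?_
    rw [hφ.coeff_familyDzbar hp, hφcoeff p hp, map_sub, map_smul, torusCoeff_mFourier]
    rcases eq_or_ne n 0 with rfl | hn
    · simp [dzbarSymbol]
    · simp [hn, dzbarSymbol_eq_zero_iff]
  have hzero : torusCoeff 0 (Ψ p) = torusCoeff 0 (Ψ (0, p.2)) := by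
    rw [hΨ.2 0 p hp, mFourier_zero]
    simp
  have hL2 : toL2 (torusTranslate
      (fun p => familyDzbar φ p - ν p * familyDz φ p - familyDz ν p) p) =
      toL2 (-torusCoeff 0 (Ψ p) • mFourier 0) := by
    rw [(hφ.familyDzbar.sub (hν.mul hφ.familyDz)).torusTranslate_sub hν.familyDz hp,
      hφ.familyDzbar.torusTranslate_sub (hν.mul hφ.familyDz) hp,
      hν.torusTranslate_mul hφ.familyDz hp, map_sub, map_sub, ← mulL2_toL2, hz, hzbar,
      ← hsolve p hp, map_smul]
    module
  -- Both sides are continuous, so equality in `L²` is pointwise; the translate by `p.1` at the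
  -- origin is the value at `p`.
  have hpt := congrArg (fun F : C(UnitAddTorus (Fin 2), ℂ) => F (coverMap 0)) (toL2_injective hL2)
  rw [((hφ.familyDzbar.sub (hν.mul hφ.familyDz)).sub hν.familyDz).torusTranslate_apply hp] at hpt
  rw [← show torusCoeff 0 (Ψ (0, p.2)) = torusCoeff 0 (beltramiSolve (torusTranslate ν (0, p.2))
        (torusTranslate (familyDz ν) (0, p.2))) from rfl, ← hzero]
  simpa [mFourier_zero] using hpt

end Beltrami

/-! ### Vanishing of the constant by a continuity argument -/

section Obstruction

open UnitAddTorus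

theorem stripDeriv_mul {u w : ℂ × ℝ → ℂ} (hu : ContDiffOn ℝ ∞ u strip)
    (hw : ContDiffOn ℝ ∞ w strip) (v : ℂ × ℝ) {p : ℂ × ℝ} (hp : p ∈ strip) :
    stripDeriv v (fun p => u p * w p) p = u p * stripDeriv v w p + w p * stripDeriv v u p := by
  have h := (hu.hasFDerivWithinAt_strip hp).mul (hw.hasFDerivWithinAt_strip hp)
  have h' := h.fderivWithin (uniqueDiffOn_strip p hp)
  simp only [stripDeriv]
  erw [h']
  rfl

theorem stripDeriv_cexp {u : ℂ × ℝ → ℂ} (hu : ContDiffOn ℝ ∞ u strip) (v : ℂ × ℝ) {p : ℂ × ℝ}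
    (hp : p ∈ strip) :
    stripDeriv v (fun p => Complex.exp (u p)) p = Complex.exp (u p) * stripDeriv v u p := by
  have h := (hu.hasFDerivWithinAt_strip hp).cexp
  simp only [stripDeriv, h.fderivWithin (uniqueDiffOn_strip p hp)]
  rfl

/-- If `φ` solves the Beltrami potential equation up to the term `c`, then `g = exp φ` satisfies
`g_z̄ - (ν g)_z = c g`. -/
theorem familyDzbar_cexp_sub {ν φ : ℂ × ℝ → ℂ} (hν : IsPeriodicFamily ν) (hφ : IsPeriodicFamily φ)
    {p : ℂ × ℝ} (hp : p ∈ strip) :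
    familyDzbar (fun p => Complex.exp (φ p)) p - familyDz (fun p => ν p * Complex.exp (φ p)) p =
      (familyDzbar φ p - ν p * familyDz φ p - familyDz ν p) * Complex.exp (φ p) := by
  simp only [familyDzbar, familyDz, stripDeriv_mul hν.1 hφ.cexp.1 _ hp, stripDeriv_cexp hφ.1 _ hp]
  ring

/-- The equation `g_z̄ - (ν g)_z = c g` at one time, in terms of Fourier coefficients. -/
theorem coeff_eq_of_familyDzbar_sub {ν g : ℂ × ℝ → ℂ} (hν : IsPeriodicFamily ν)
    (hg : IsPeriodicFamily g) {p : ℂ × ℝ} (hp : p ∈ strip) {c : ℂ}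
    (h : ∀ z, familyDzbar g (z, p.2) - familyDz (fun p => ν p * g p) (z, p.2) = c * g (z, p.2)) :
    ∀ n, dzbarSymbol n * torusCoeff n (toL2 (torusTranslate g p)) - dzSymbol n *
      torusCoeff n (mulL2 (torusTranslate ν p) (toL2 (torusTranslate g p))) =
      c * torusCoeff n (toL2 (torusTranslate g p)) := by
  intro n
  have h1 : torusTranslate (familyDzbar g) p - torusTranslate (familyDz fun p => ν p * g p) p =
      c • torusTranslate g p := by
    refine ContinuousMap.ext_coverMap fun z => ?_
    simp only [ContinuousMap.sub_apply, ContinuousMap.smul_apply, smul_eq_mul,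
      hg.familyDzbar.torusTranslate_apply hp, (hν.mul hg).familyDz.torusTranslate_apply hp,
      hg.torusTranslate_apply hp, h]
  have h2 := congrArg (fun F => torusCoeff n (toL2 F)) h1
  simp only [map_sub, map_smul, hg.coeff_familyDzbar hp, (hν.mul hg).coeff_familyDz hp,
    hν.torusTranslate_mul hg hp, ← mulL2_toL2, smul_eq_mul] at h2
  exact h2

/-- A solution of mean zero of `g_z̄ = (ν g)_z` on the torus vanishes. -/
theorem eq_zero_of_mean_eq_zero {ν g : ℂ × ℝ → ℂ} (hν : IsPeriodicFamily ν)
    (hlt : ∀ p ∈ strip, ‖ν p‖ < 1) (hg : IsPeriodicFamily g) {p : ℂ × ℝ} (hp : p ∈ strip)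
    (h : ∀ z, familyDzbar g (z, p.2) - familyDz (fun p => ν p * g p) (z, p.2) = 0)
    (hmean : torusCoeff 0 (toL2 (torusTranslate g p)) = 0) : g p = 0 := by
  have hcoeff := coeff_eq_of_familyDzbar_sub hν hg hp (c := 0) (by simpa using h)
  set G := toL2 (torusTranslate g p) with hG
  -- Nonzero modes are divided by the symbol of `∂_z̄`; the zero mode is `hmean`. The right side is
  -- a strict contraction in `G`.
  have hfix : G = beurling (mulL2 (torusTranslate ν p) G) := by
    refine TorusL2.ext_coeff fun n => ?_
    rw [torusCoeff_beurling]
    rcases eq_or_ne n 0 with rfl | hn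
    · simp [hmean, dzbarSymbol]
    · have h1 : dzbarSymbol n ≠ 0 := dzbarSymbol_eq_zero_iff.not.2 hn
      have := hcoeff n
      field_simp
      linear_combination this
  have hnorm := hν.norm_torusTranslate_lt hp one_pos hlt
  have hle : ‖G‖ ≤ ‖torusTranslate ν p‖ * ‖G‖ := by
    calc ‖G‖ = ‖beurling (mulL2 (torusTranslate ν p) G)‖ := by rw [← hfix]
      _ ≤ 1 * ‖mulL2 (torusTranslate ν p) G‖ :=
        beurling.le_of_opNorm_le norm_beurling_le _
      _ ≤ _ := by
        rw [one_mul]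
        exact (mulL2 (torusTranslate ν p)).le_of_opNorm_le (norm_mulL2_le _) _
  have hG0 : G = 0 := by
    by_contra hne
    have := norm_pos_iff.2 hne
    nlinarith
  have : torusTranslate g p = 0 := toL2_injective (by rw [← hG, hG0, map_zero])
  have h0 := hg.torusTranslate_apply hp 0
  rw [this] at h0
  simpa using h0.symm

theorem familyDz_eq_of_slice_eq {u w : ℂ × ℝ → ℂ} (hu : IsPeriodicFamily u)
    (hw : IsPeriodicFamily w) {z : ℂ} {s t : ℝ} (hs : s ∈ Icc (0 : ℝ) 1) (ht : t ∈ Icc (0 : ℝ) 1)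
    (h : ∀ z, u (z, s) = w (z, t)) : familyDz u (z, s) = familyDz w (z, t) := by
  have hs' : (z, s) ∈ strip := mem_strip.2 hs
  have ht' : (z, t) ∈ strip := mem_strip.2 ht
  simp only [familyDz, stripDeriv_eq_fderiv_slice hu.1 hs', stripDeriv_eq_fderiv_slice hw.1 ht', h]

theorem torusTranslate_eq_of_slice_eq {u w : ℂ × ℝ → ℂ} {s t : ℝ}
    (h : ∀ z, u (z, s) = w (z, t)) : torusTranslate u (0, s) = torusTranslate w (0, t) := by
  simp only [torusTranslate, h]

/-- The constants in `exists_beltrami_potential` vanish, by deforming `ν` to zero. -/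
theorem beltrami_obstruction_eq_zero {ν : ℂ × ℝ → ℂ} (hν : IsPeriodicFamily ν)
    (hlt : ∀ p ∈ strip, ‖ν p‖ < 1) {t : ℝ} (ht : t ∈ Icc (0 : ℝ) 1) :
    torusCoeff 0 (beltramiSolve (torusTranslate ν (0, t))
        (torusTranslate (familyDz ν) (0, t))) = 0 := by
  -- The time `t` is frozen; the strip parameter now scales `ν(·, t)` from zero.
  let μ : ℂ × ℝ → ℂ := fun p => (p.2 : ℂ) * ν (p.1, t)
  have hμ : IsPeriodicFamily μ := by
    refine ⟨?_, fun l hl z s hs => by simp only [μ, hν.2 l hl z t ht]⟩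
    exact ((Complex.ofRealCLM.contDiff.comp contDiff_snd).mul
      ((contDiff_slice hν.1 ht).comp contDiff_fst)).contDiffOn
  have hμlt : ∀ p ∈ strip, ‖μ p‖ < 1 := fun p hp => by
    have h01 := mem_strip.1 hp
    rw [norm_mul, Complex.norm_real, Real.norm_of_nonneg h01.1]
    exact (mul_le_of_le_one_left (norm_nonneg _) h01.2).trans_lt (hlt (p.1, t) (mem_strip.2 ht))
  obtain ⟨φ, hφ, hφeq⟩ := exists_beltrami_potential hμ hμlt
  set c : ℝ → ℂ := fun s => torusCoeff 0 (beltramiSolve (torusTranslate μ (0, s))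
    (torusTranslate (familyDz μ) (0, s))) with hc
  have hc1 : c 1 = torusCoeff 0 (beltramiSolve (torusTranslate ν (0, t))
      (torusTranslate (familyDz ν) (0, t))) := by
    have hsl : ∀ z, μ (z, 1) = ν (z, t) := fun z => by simp [μ]
    simp only [hc, torusTranslate_eq_of_slice_eq hsl, torusTranslate_eq_of_slice_eq
      fun z => familyDz_eq_of_slice_eq hμ hν (right_mem_Icc.2 zero_le_one) ht hsl]
  have hc0 : c 0 = 0 := by
    have hsl : ∀ z, μ (z, 0) = (fun _ => 0 : ℂ × ℝ → ℂ) (z, 0) := fun z => by simp [μ]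
    have h0 : ∀ z, familyDz μ (z, 0) = (fun _ => 0 : ℂ × ℝ → ℂ) (z, 0) := fun z => by
      rw [familyDz_eq_of_slice_eq hμ (IsPeriodicFamily.const 0) (left_mem_Icc.2 zero_le_one)
        (left_mem_Icc.2 zero_le_one) hsl]
      simp [familyDz, stripDeriv]
    have h1 : torusTranslate (fun _ => 0 : ℂ × ℝ → ℂ) (0, 0) = 0 :=
      ContinuousMap.ext_coverMap fun z =>
        (IsPeriodicFamily.const 0).torusTranslate_apply (mem_strip.2 (left_mem_Icc.2 zero_le_one)) z
    have h2 : torusTranslate (familyDz μ) (0, 0) = 0 :=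
      (torusTranslate_eq_of_slice_eq (w := fun _ => 0) (t := 0) h0).trans h1
    simp only [hc, h2, beltramiSolve, map_zero]
  let g : ℂ × ℝ → ℂ := fun p => Complex.exp (φ p)
  have hg : IsPeriodicFamily g := hφ.cexp
  let M : ℝ → ℂ := fun s => torusCoeff 0 (toL2 (torusTranslate g (0, s)))
  have hgeq : ∀ s ∈ Icc (0 : ℝ) 1, ∀ z, familyDzbar g (z, s) -
      familyDz (fun p => μ p * g p) (z, s) = -c s * g (z, s) := fun s hs z => by
    rw [familyDzbar_cexp_sub hμ hφ (mem_strip.2 hs), hφeq _ (mem_strip.2 hs)]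
  -- Derivatives have no zero mode, so the zero mode of the equation reads `c s * M s = 0`.
  have hcM : ∀ s ∈ Icc (0 : ℝ) 1, c s = 0 ∨ M s = 0 := fun s hs => by
    have := coeff_eq_of_familyDzbar_sub hμ hg (p := (0, s)) (mem_strip.2 hs) (hgeq s hs) 0
    simpa [dzbarSymbol, dzSymbol, M] using this
  have hcM' : ∀ s ∈ Icc (0 : ℝ) 1, c s = 0 → M s ≠ 0 := fun s hs hcs hMs =>
    Complex.exp_ne_zero (φ (0, s)) <| eq_zero_of_mean_eq_zero hμ hμlt hg (p := (0, s))
      (mem_strip.2 hs) (fun z => by simpa [hcs] using hgeq s hs z) hMs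
  have hline : ContinuousOn (fun s : ℝ => ((0 : ℂ), s)) (Icc 0 1) := by fun_prop
  have hmaps : MapsTo (fun s : ℝ => ((0 : ℂ), s)) (Icc 0 1) strip := fun s hs => mem_strip.2 hs
  -- Continuity is read off from the potential equation at the origin of the plane.
  have hccont : ContinuousOn c (Icc 0 1) := by
    have := ((((hφ.familyDzbar.sub (hμ.mul hφ.familyDz)).sub hμ.familyDz).1.continuousOn).comp
      hline hmaps).neg
    exact this.congr fun s hs => by
      simp only [Pi.neg_apply, Function.comp_apply, hφeq _ (hmaps hs), hc, neg_neg]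
  have hMcont : ContinuousOn M (Icc 0 1) :=
    (torusCoeff 0).continuous.comp_continuousOn
      (hg.isEquivariantFamily.1.continuousOn.comp hline hmaps)
  rw [continuousOn_iff_continuous_domRestrict] at hccont hMcont
  let A : Set (Icc (0 : ℝ) 1) := {s | c s = 0}
  have hA : IsClosed A := isClosed_singleton.preimage hccont
  have hB : IsClosed {s : Icc (0 : ℝ) 1 | M s = 0} := isClosed_singleton.preimage hMcont
  have hAB : Aᶜ = {s : Icc (0 : ℝ) 1 | M s = 0} := by
    ext s
    exact ⟨fun h => (hcM s s.2).resolve_left h, fun h h' => hcM' s s.2 h' h⟩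
  have hclopen : IsClopen A := ⟨hA, by rw [← isClosed_compl_iff, hAB]; exact hB⟩
  have huniv := hclopen.eq_univ ⟨⟨0, left_mem_Icc.2 zero_le_one⟩, hc0⟩
  have : (⟨1, right_mem_Icc.2 zero_le_one⟩ : Icc (0 : ℝ) 1) ∈ A := huniv ▸ mem_univ _
  rw [← hc1]
  exact this

/-- Every smooth family `ν` of Beltrami coefficients on the torus has a smooth family of nowhere
vanishing integrating factors. -/
theorem exists_integrating_factor {ν : ℂ × ℝ → ℂ} (hν : IsPeriodicFamily ν)
    (hlt : ∀ p ∈ strip, ‖ν p‖ < 1) :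
    ∃ g, IsPeriodicFamily g ∧ (∀ p, g p ≠ 0) ∧
      ∀ p ∈ strip, familyDzbar g p = familyDz (fun p => ν p * g p) p := by
  obtain ⟨φ, hφ, hφeq⟩ := exists_beltrami_potential hν hlt
  refine ⟨fun p => Complex.exp (φ p), hφ.cexp, fun p => Complex.exp_ne_zero _, fun p hp => ?_⟩
  rw [← sub_eq_zero, familyDzbar_cexp_sub hν hφ hp, hφeq p hp,
    beltrami_obstruction_eq_zero hν hlt (mem_strip.1 hp), neg_zero, zero_mul]

end Obstruction

/-! ### Global inversion for periodic derivatives -/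

section GlobalInverse

/-- A proper local homeomorphism of the plane is a homeomorphism. -/
theorem IsProperMap.exists_homeomorph_complex {Φ : ℂ → ℂ} (hp : IsProperMap Φ)
    (hl : IsLocalHomeomorph Φ) : ∃ e : ℂ ≃ₜ ℂ, ∀ z, e z = Φ z := by
  have hfin : ∀ w ∈ (univ : Set ℂ), (Φ ⁻¹' {w}).Finite := fun w _ =>
    (hp.isCompact_preimage isCompact_singleton).finite
      (IsDiscrete.of_openPartialHomeomorph Φ (subset_refl _) fun e _ =>
        let ⟨φ, hφ, h⟩ := hl e
        ⟨φ, hφ, h.symm⟩)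
  have hcov : IsCoveringMap Φ := by
    rw [isCoveringMap_iff_isCoveringMapOn_univ]
    refine hp.isClosedMap.isCoveringMapOn_of_isLocalHomeomorphOn hfin ?_
    rwa [preimage_univ, ← isLocalHomeomorph_iff_isLocalHomeomorphOn_univ]
  -- The identity of the simply connected plane lifts to a section `σ`; uniqueness of lifts makes it
  -- a two-sided inverse.
  obtain ⟨σ, ⟨hσ0, hσ⟩, -⟩ := hcov.existsUnique_continuousMap_lifts (ContinuousMap.id ℂ) (Φ 0) 0 rfl
  have hright : ∀ w, Φ (σ w) = w := congrFun hσ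
  have hleft : σ ∘ Φ = id :=
    hcov.eq_of_comp_eq (σ.continuous.comp hp.continuous) continuous_id
      (funext fun z => hright (Φ z)) 0 hσ0
  exact ⟨⟨⟨Φ, σ, congrFun hleft, hright⟩, hp.continuous, σ.continuous⟩, fun _ => rfl⟩

/-- A smooth map of the plane whose derivative is periodic is the sum of a linear map and a periodic
map. -/
theorem exists_linear_add_periodic {Φ : ℂ → ℂ} {α : ℂ → ℂ →L[ℝ] ℂ}
    (hper : ∀ l ∈ periodLattice, ∀ z, α (z + l) = α z) (hΦ : ∀ z, HasFDerivAt Φ (α z) z) :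
    ∃ L : ℂ →L[ℝ] ℂ, ∀ l ∈ periodLattice, ∀ z, Φ (z + l) - L (z + l) = Φ z - L z := by
  have hshift : ∀ l ∈ periodLattice, ∀ z, Φ (z + l) - Φ z = Φ l - Φ 0 := by
    intro l hl z
    have hd : ∀ z, HasFDerivAt (fun z => Φ (z + l) - Φ z) (0 : ℂ →L[ℝ] ℂ) z := fun z => by
      have h1 : HasFDerivAt (fun z => Φ (z + l)) (α (z + l)) z :=
        (hasFDerivAt_comp_add_right l).2 (hΦ (z + l))
      refine (h1.sub (hΦ z)).congr_fderiv ?_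
      rw [hper l hl, sub_self]
    have := is_const_of_fderiv_eq_zero (fun z => (hd z).differentiableAt)
      (fun z => (hd z).fderiv) z 0
    simpa using this
  have hpi := Real.pi_pos.ne'
  let a : ℂ := 2 * Real.pi
  let b : ℂ := 2 * Real.pi * Complex.I
  have ha : a ∈ periodLattice := ⟨1, 0, by simp [a]⟩
  have hb : b ∈ periodLattice := ⟨0, 1, by simp [b]⟩
  let L : ℂ →L[ℝ] ℂ :=
    Complex.reCLM.smulRight ((2 * Real.pi)⁻¹ • (Φ a - Φ 0)) +
    Complex.imCLM.smulRight ((2 * Real.pi)⁻¹ • (Φ b - Φ 0))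
  have hLa : L a = Φ a - Φ 0 := by
    simp [L, a]
    field_simp
  have hLb : L b = Φ b - Φ 0 := by
    simp [L, b]
    field_simp
  let P : ℂ → ℂ := fun z => Φ z - L z
  have hPa : Function.Periodic P a := fun z => by
    simp only [P, map_add, hLa]
    linear_combination hshift a ha z
  have hPb : Function.Periodic P b := fun z => by
    simp only [P, map_add, hLb]
    linear_combination hshift b hb z
  refine ⟨L, ?_⟩
  rintro l ⟨m, n, rfl⟩ z
  have h := (hPa.int_mul m).add_period (hPb.int_mul n) z
  have hl : (m : ℂ) * a + n * b = 2 * Real.pi * m + 2 * Real.pi * n * Complex.I := by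
    simp only [a, b]
    ring
  rwa [hl] at h

/-- A smooth local diffeomorphism of the plane with periodic derivative is a diffeomorphism. -/
theorem exists_diffeomorph_of_periodic_fderiv {Φ : ℂ → ℂ} {α : ℂ → ℂ →L[ℝ] ℂ}
    (hα : ContDiff ℝ ∞ α) (hper : ∀ l ∈ periodLattice, ∀ z, α (z + l) = α z)
    (hinj : ∀ z, Function.Injective (α z)) (hΦ : ∀ z, HasFDerivAt Φ (α z) z) :
    ∃ e : Diffeomorph 𝓘(ℝ, ℂ) 𝓘(ℝ, ℂ) ℂ ℂ ∞, ∀ z, e z = Φ z := by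
  have hsurj : ∀ z, Function.Surjective (α z) := fun z =>
    (LinearMap.injective_iff_surjective (f := (α z : ℂ →ₗ[ℝ] ℂ))).1 (hinj z)
  let e : ℂ → ℂ ≃L[ℝ] ℂ := fun z =>
    (LinearEquiv.ofInjectiveEndo (α z : ℂ →ₗ[ℝ] ℂ) (hinj z)).toContinuousLinearEquiv
  have he : ∀ z, (e z : ℂ →L[ℝ] ℂ) = α z := fun z => by
    exact ContinuousLinearMap.ext fun w => rfl
  have hΦs : ContDiff ℝ ∞ Φ := contDiff_infty_iff_fderiv.2
    ⟨fun z => (hΦ z).differentiableAt, by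
      rwa [show fderiv ℝ Φ = α from funext fun z => (hΦ z).fderiv]⟩
  have hlocal : IsLocalHomeomorph Φ := fun z => by
    have hs : HasStrictFDerivAt Φ (e z : ℂ →L[ℝ] ℂ) z :=
      hΦs.contDiffAt.hasStrictFDerivAt' ((he z).symm ▸ hΦ z) (by simp)
    exact ⟨hs.toOpenPartialHomeomorph Φ, hs.mem_toOpenPartialHomeomorph_source, rfl⟩
  obtain ⟨L, hL⟩ := exists_linear_add_periodic hper hΦ
  let P : ℂ → ℂ := fun z => Φ z - L z
  have hPc : Continuous P := hΦs.continuous.sub L.continuous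
  have hPT : ∀ z, torusDescend P (coverMap z) = P z := torusDescend_coverMap hPc hL
  -- Otherwise a nonzero functional `A` kills the range of `L`, so `A ∘ Φ` is periodic and attains a
  -- maximum; its derivative vanishes there, contradicting surjectivity of `α`.
  have hLsurj : LinearMap.range (L : ℂ →ₗ[ℝ] ℂ) = ⊤ := by
    by_contra hne
    obtain ⟨A, hA0, hA⟩ := Submodule.exists_le_ker_of_lt_top _ (lt_top_iff_ne_top.2 hne)
    have hAL : ∀ z, A (L z) = 0 := fun z => hA ⟨z, rfl⟩
    let A' : ℂ →L[ℝ] ℝ := LinearMap.toContinuousLinearMap A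
    obtain ⟨x, -, hx⟩ := isCompact_univ.exists_isMaxOn (univ_nonempty)
      (A'.continuous.comp (torusDescend P).continuous).continuousOn
    obtain ⟨z₀, rfl⟩ := isOpenQuotientMap_coverMap.surjective x
    have hmax : IsLocalMax (fun z => A' (Φ z)) z₀ := by
      refine .of_forall fun z => ?_
      have h1 : A' (torusDescend P (coverMap z)) ≤ A' (torusDescend P (coverMap z₀)) :=
        hx (mem_univ (coverMap z))
      have h2 : ∀ z, A' (torusDescend P (coverMap z)) = A' (Φ z) := fun z => by
        rw [hPT, map_sub, show A' (L z) = 0 from hAL z, sub_zero]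
      rwa [h2, h2] at h1
    have hz := hmax.hasFDerivAt_eq_zero (A'.hasFDerivAt.comp z₀ (hΦ z₀))
    refine hA0 (LinearMap.ext fun w => ?_)
    obtain ⟨v, rfl⟩ := hsurj z₀ w
    exact congrArg (fun B : ℂ →L[ℝ] ℝ => B v) hz
  have hLinj : Function.Injective (L : ℂ →ₗ[ℝ] ℂ) :=
    LinearMap.injective_iff_surjective.2 (LinearMap.range_eq_top.1 hLsurj)
  let Le : ℂ ≃L[ℝ] ℂ :=
    (LinearEquiv.ofInjectiveEndo (L : ℂ →ₗ[ℝ] ℂ) hLinj).toContinuousLinearEquiv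
  have hLe : ∀ z, Le z = L z := fun z => rfl
  have hproper : IsProperMap Φ := by
    rw [isProperMap_iff_tendsto_cocompact]
    refine ⟨hΦs.continuous, ?_⟩
    have hLt : Tendsto (fun z => ‖L z‖ - ‖torusDescend P‖) (cocompact ℂ) atTop :=
      tendsto_atTop_add_const_right _ _ (tendsto_norm_cocompact_atTop.comp
        Le.toHomeomorph.isClosedEmbedding.tendsto_cocompact)
    rw [← Metric.cobounded_eq_cocompact, ← tendsto_norm_atTop_iff_cobounded,
      Metric.cobounded_eq_cocompact]
    refine tendsto_atTop_mono (fun z => ?_) hLt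
    have h1 : ‖P z‖ ≤ ‖torusDescend P‖ := by
      rw [← hPT]
      exact ContinuousMap.norm_coe_le_norm _ _
    have h2 : L z = Φ z - P z := by simp [P]
    rw [h2]
    linarith [norm_sub_le (Φ z) (P z)]
  obtain ⟨E, hE⟩ := hproper.exists_homeomorph_complex hlocal
  have hE' : (E : ℂ → ℂ) = Φ := funext hE
  refine ⟨⟨E.toEquiv, ContDiff.contMDiff (f := E) (hE' ▸ hΦs), ContDiff.contMDiff (f := E.symm)
    (E.contDiff_symm (f₀' := e) (fun z => ?_) (hE' ▸ hΦs))⟩, hE⟩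
  rw [hE', he]
  exact hΦ z

end GlobalInverse

/-! ### Descent to the torus and closedness of the form -/

section Uniformization

theorem torusProj_add_period {l : ℂ} (hl : l ∈ periodLattice) (z : ℂ) :
    torusProj (z + l) = torusProj z := by
  rw [torusProj, torusProj, QuotientAddGroup.eq]
  simpa using hl

theorem IsSmoothFamily.isPeriodicFamily {u : Torus2 → Icc (0 : ℝ) 1 → ℂ} (hu : IsSmoothFamily u) :
    IsPeriodicFamily fun p => u (torusProj p.1) (projIcc (0 : ℝ) 1 zero_le_one p.2) :=
  ⟨hu, fun l hl z t _ => by simp only [torusProj_add_period hl]⟩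

/-- A periodic family descends to the torus. -/
theorem IsPeriodicFamily.exists_descend {g : ℂ × ℝ → ℂ} (hg : IsPeriodicFamily g) :
    ∃ f : Torus2 → Icc (0 : ℝ) 1 → ℂ, IsSmoothFamily f ∧ (∀ z t, f (torusProj z) t = g (z, t)) := by
  have key : ∀ z (t : Icc (0 : ℝ) 1), g (Quotient.out (torusProj z), t) = g (z, t) := by
    intro z t
    have hout : torusProj (Quotient.out (torusProj z)) = torusProj z := Quotient.out_eq _
    have hl : -z + Quotient.out (torusProj z) ∈ periodLattice := QuotientAddGroup.eq.1 hout.symm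
    simpa using hg.2 _ hl z t t.2
  refine ⟨fun x t => g (Quotient.out x, t), ?_, key⟩
  refine hg.1.congr fun p hp => ?_
  have ht := mem_strip.1 hp
  rw [projIcc_of_mem zero_le_one ht]
  exact key p.1 ⟨p.2, ht⟩

/-- The pullback of a form `g (dz + μ dz̄)` to the plane in terms of lifts of `g` and `μ`. -/
theorem beltramiForm_pullback {g μ : Torus2 → ℂ} (z w : ℂ) :
    (beltramiForm g μ).pullback z w =
      g (torusProj z) * w + μ (torusProj z) * g (torusProj z) * starRingEnd ℂ w := by
  simp [TorusOneForm.pullback, beltramiForm]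
  ring

/-- The form `F dz + P dz̄` on the plane has symmetric derivative if `F_z̄ = P_z`. -/
theorem fderiv_symm_of_dbar_eq {F P : ℂ → ℂ} {α : ℂ → ℂ →L[ℝ] ℂ} (hF : ContDiff ℝ ∞ F)
    (hP : ContDiff ℝ ∞ P) (hα : ∀ z w, α z w = F z * w + P z * starRingEnd ℂ w) (z : ℂ)
    (h : fderiv ℝ F z 1 + Complex.I * fderiv ℝ F z Complex.I =
      fderiv ℝ P z 1 - Complex.I * fderiv ℝ P z Complex.I) :
    ContDiff ℝ ∞ α ∧ ∀ v w, fderiv ℝ α z v w = fderiv ℝ α z w v := by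
  have hαeq : α = fun z => F z • ContinuousLinearMap.id ℝ ℂ + P z • (Complex.conjCLE : ℂ →L[ℝ] ℂ) := by
    funext z
    refine ContinuousLinearMap.ext fun w => ?_
    simp [hα]
  have hαs : ContDiff ℝ ∞ α := by
    rw [hαeq]
    exact (hF.smul contDiff_const).add (hP.smul contDiff_const)
  refine ⟨hαs, fun v w => ?_⟩
  have hFd : DifferentiableAt ℝ F z := hF.differentiable (by simp) z
  have hPd : DifferentiableAt ℝ P z := hP.differentiable (by simp) z
  have hαd : DifferentiableAt ℝ α z := hαs.differentiable (by simp) z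
  have hD : ∀ v w, fderiv ℝ α z v w = fderiv ℝ F z v * w + fderiv ℝ P z v * starRingEnd ℂ w := by
    intro v w
    have h1 : HasFDerivAt (fun z => α z w) ((fderiv ℝ α z).flip w) z := by
      simpa using hαd.hasFDerivAt.clm_apply (hasFDerivAt_const w z)
    have h2 := (hFd.hasFDerivAt.mul_const w).add (hPd.hasFDerivAt.mul_const (starRingEnd ℂ w))
    have h3 := h1.unique (h2.congr_of_eventuallyEq (.of_forall fun z => hα z w))
    have h4 := congrArg (fun B : ℂ →L[ℝ] ℂ => B v) h3
    simp only [ContinuousLinearMap.flip_apply] at h4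
    rw [h4]
    simp [mul_comm]
  have hlin : ∀ (A : ℂ →L[ℝ] ℂ) (v : ℂ), A v = v.re * A 1 + v.im * A Complex.I := fun A v => by
    have hv : v = v.re • (1 : ℂ) + v.im • Complex.I := by
      apply Complex.ext <;> simp
    conv_lhs => rw [hv, map_add, map_smul, map_smul]
    simp
  have hw : ∀ w : ℂ, w = w.re + w.im * Complex.I := fun w => (Complex.re_add_im w).symm
  have hconj : ∀ w : ℂ, starRingEnd ℂ w = w.re - w.im * Complex.I := fun w => by
    apply Complex.ext <;> simp
  rw [hD, hD, hlin _ v, hlin _ w, hlin (fderiv ℝ P z) v, hlin (fderiv ℝ P z) w, hconj v, hconj w]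
  -- The antisymmetric part is `v.re * w.im - v.im * w.re` times its value on `(1, I)`, which `h`
  -- annihilates.
  linear_combination Complex.I * ((v.re : ℂ) * w.im - v.im * w.re) * h +
    (v.re * fderiv ℝ F z 1 + v.im * fderiv ℝ F z Complex.I) * hw w -
    (w.re * fderiv ℝ F z 1 + w.im * fderiv ℝ F z Complex.I) * hw v -
    ((v.re : ℂ) * w.im - v.im * w.re) * (fderiv ℝ F z Complex.I + fderiv ℝ P z Complex.I) *
      Complex.I_sq

/-- A one-form on the torus whose pullback has symmetric derivative is closed. -/
theorem TorusOneForm.isClosed_of_fderiv_symm {α : TorusOneForm} (hα : Differentiable ℝ α.pullback)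
    (h : ∀ z v w, fderiv ℝ α.pullback z v w = fderiv ℝ α.pullback z w v) : α.IsClosed := by
  refine ⟨hα, fun z => ?_⟩
  have hd : DifferentiableAt ℝ (fun w => ContinuousAlternatingMap.ofSubsingleton ℝ ℂ ℂ (0 : Fin 1)
      (α.pullback w)) z :=
    (ContinuousAlternatingMap.ofSubsingletonLIE (𝕜 := ℝ) (E := ℂ) (F := ℂ)
      (0 : Fin 1)).toContinuousLinearEquiv.differentiableAt.comp z (hα z)
  have happly : ∀ w v, fderiv ℝ (fun x => α.pullback x w) z v = fderiv ℝ α.pullback z v w := by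
    intro w v
    have h1 : HasFDerivAt (fun x => α.pullback x w) ((fderiv ℝ α.pullback z).flip w) z := by
      simpa using (hα z).hasFDerivAt.clm_apply (hasFDerivAt_const w z)
    rw [h1.fderiv]
    rfl
  ext v
  rw [extDeriv_apply hd]
  simp [Fin.sum_univ_two, happly, Fin.removeNth, h _ (v 0) (v 1)]

end Uniformization

end TorusBeltrami

theorem theorem4 (ν : Torus2 → Icc (0 : ℝ) 1 → ℂ)
    (hν : IsSmoothFamily ν) (hν_lt : ∀ x t, ‖ν x t‖ < 1) :
    ∃ f : Torus2 → Icc (0 : ℝ) 1 → ℂ,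
      IsSmoothFamily f ∧ (∀ x t, f x t ≠ 0) ∧
      ∀ t : Icc (0 : ℝ) 1,
        (beltramiForm (fun x => f x t) (fun x => ν x t)).IsClosed ∧
        ∃ Φ : Diffeomorph 𝓘(ℝ, ℂ) 𝓘(ℝ, ℂ) ℂ ℂ ∞, ∀ z : ℂ,
          HasFDerivAt Φ ((beltramiForm (fun x => f x t) (fun x => ν x t)).pullback z) z := by
  have hN := hν.isPeriodicFamily
  obtain ⟨g, hg, hg0, hgeq⟩ := exists_integrating_factor hN fun p _ => hν_lt _ _
  obtain ⟨f, hf, hfg⟩ := hg.exists_descend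
  have hf0 : ∀ x t, f x t ≠ 0 := fun x t => by
    obtain ⟨z, rfl⟩ := QuotientAddGroup.mk_surjective x
    exact (hfg z t).symm ▸ hg0 _
  refine ⟨f, hf, hf0, fun t => ?_⟩
  let α : TorusOneForm := beltramiForm (fun x => f x t) (fun x => ν x t)
  let P : ℂ × ℝ → ℂ := fun p =>
    ν (torusProj p.1) (projIcc (0 : ℝ) 1 zero_le_one p.2) * g p
  have hP : IsPeriodicFamily P := hN.mul hg
  have hα : ∀ z w, α.pullback z w = g (z, t) * w + P (z, t) * starRingEnd ℂ w := fun z w => by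
    simp only [α, beltramiForm_pullback, hfg, P, projIcc_val]
  have hsymm : ∀ z, ContDiff ℝ ∞ α.pullback ∧
      ∀ v w, fderiv ℝ α.pullback z v w = fderiv ℝ α.pullback z w v := by
    intro z
    refine fderiv_symm_of_dbar_eq (contDiff_slice hg.1 t.2) (contDiff_slice hP.1 t.2) hα z ?_
    have hz : (z, (t : ℝ)) ∈ strip := mem_strip.2 t.2
    have h := hgeq _ hz
    change _ = familyDz P _ at h
    simp only [familyDzbar, familyDz, stripDeriv_eq_fderiv_slice hg.1 hz,
      stripDeriv_eq_fderiv_slice hP.1 hz] at h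
    linear_combination 2 * h
  have hαs : ContDiff ℝ ∞ α.pullback := (hsymm 0).1
  refine ⟨TorusOneForm.isClosed_of_fderiv_symm (hαs.differentiable (by simp))
    fun z => (hsymm z).2, ?_⟩
  -- Poincaré lemma on the plane.
  obtain ⟨Φ, hΦ⟩ := convex_univ.exists_forall_hasFDerivAt_of_fderiv_symmetric isOpen_univ
    (hαs.differentiable (by simp)).differentiableOn fun z _ => (hsymm z).2
  have hper : ∀ l ∈ periodLattice, ∀ z, α.pullback (z + l) = α.pullback z := fun l hl z => by
    simp only [TorusOneForm.pullback, torusProj_add_period hl]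
  have hinj : ∀ z, Function.Injective (α.pullback z) := by
    intro z
    rw [injective_iff_map_eq_zero]
    intro w hw
    have hlt := hν_lt (torusProj z) t
    have h0 : f (torusProj z) t * (w + ν (torusProj z) t * starRingEnd ℂ w) = 0 := by
      rw [← hw]
      simp only [α, beltramiForm_pullback]
      ring
    -- A kernel vector satisfies `‖w‖ = ‖ν‖ ‖w‖` with `‖ν‖ < 1`, hence vanishes.
    have h1 := congrArg norm
      (eq_neg_of_add_eq_zero_left ((mul_eq_zero.1 h0).resolve_left (hf0 _ _)))
    rw [norm_neg, norm_mul, RCLike.norm_conj] at h1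
    by_contra hne
    have := norm_pos_iff.2 hne
    nlinarith
  obtain ⟨e, he⟩ := exists_diffeomorph_of_periodic_fderiv hαs hper hinj fun z => hΦ z (mem_univ z)
  exact ⟨e, fun z => (hΦ z (mem_univ z)).congr_of_eventuallyEq (.of_forall he)⟩
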